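/- Let $p$ be an odd prime, $\zeta$ a primitive $p$-th root of unity, $K=\mathbb{Q}(\zeta)$ with ring of integers $\mathbb{Z}[\zeta]$, and $\pi=(1-\zeta)\mathbb{Z}[\zeta]$ the prime ideal above $p$. Let $u$ be a primitive root modulo $p$ and $\sigma\in\mathrm{Gal}(K/\mathbb{Q})$ the automorphism with $\sigma(\zeta)=\zeta^u$; a bar denotes complex conjugation. Let $C_p$ be the group of ideal classes $c$ of $K$ with $c^p=1$, and let $C_p^-$ be its relative (minus) part, the group of those $c\in C_p$ with $c\,\bar c=1$. For $x\in K$ and $n\ge 0$, $\pi^n\mid x$ (equivalently $x\equiv 0 \bmod \pi^n$) means that $x=a/s$ with $a\in\pi^n$, $s\in\mathbb{Z}[\zeta]\setminus\pi$; and $\pi^n\,\|\,x$ means $\pi^n\mid x$ and $\pi^{n+1}\nmid x$. An element $x\in K$ is called singular if $x\mathbb{Z}[\zeta]=\mathfrak{a}^p$ for a non-principal fractional ideal $\mathfrak{a}$ of $K$, and primary if $x\equiv c^p \bmod \pi^p$ for some $c\in\mathbb{Z}$ with $p\nmid c$. Let $\mathbf{b}$ be a non-principal ideal of $\mathbb{Z}[\zeta]$,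 prime to $\pi$, whose class lies in $C_p^-$ and which satisfies $\mathrm{Cl}(\sigma(\mathbf{b}))=\mathrm{Cl}(\mathbf{b})^{\mu}$ for some $\mu\in\mathbb{F}_p$. Then there is an integer $m$ with $1\le m\le \frac{p-3}{2}$ and $\mu= u^{2m+1}$ in $\mathbb{F}_p$, such that: 1. there is a singular algebraic integer $B\in\mathbb{Z}[\zeta]$ with $$B\,\mathbb{Z}[\zeta]=\mathbf{b}^p,\qquad C=\frac{B}{\overline{B}}\equiv 1 \bmod \pi^{2m+1};$$ 2. for every $B\in\mathbb{Z}[\zeta]$ with $B\,\mathbb{Z}[\zeta]=\mathbf{b}^p$ and $C=B/\overline{B}\equiv 1\bmod \pi^{2m+1}$, either $C$ is singular and not primary with $\pi^{2m+1}\,\|\,C-1$, or $C$ is singular and primary with $\pi^p\mid C-1$. -/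

import Mathlib

open NumberField nonZeroDivisors

namespace CycloSingular

noncomputable section

variable {K : Type*} [Field K] [NumberField K]

/-- The image `σ(I)` of a nonzero integral ideal `I` of `K` under a `ℚ`-automorphism `σ` of `K`. -/
def galIdeal (σ : Gal(K/ℚ)) (I : (Ideal (𝓞 K))⁰) : (Ideal (𝓞 K))⁰ :=
  ⟨(I : Ideal (𝓞 K)).map (RingOfIntegers.mapRingEquiv (σ : K ≃+* K)), by
    rw [mem_nonZeroDivisors_iff_ne_zero]
    intro h
    exact nonZeroDivisors.coe_ne_zero I
      ((Ideal.map_eq_bot_iff_of_injective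
        (RingOfIntegers.mapRingEquiv (σ : K ≃+* K)).injective).1 h)⟩

/-- The action of a `ℚ`-automorphism of `K` on the ideal class group of `K`. -/
def galClass (σ : Gal(K/ℚ)) : ClassGroup (𝓞 K) ≃* ClassGroup (𝓞 K) :=
  ClassGroup.mulEquiv (RingOfIntegers.mapRingEquiv (σ : K ≃+* K))

/-- On the class of an integral ideal `I`, the action is `Cl(I) ↦ Cl(σ(I))`. -/
theorem galClass_mk0 (σ : Gal(K/ℚ)) (I : (Ideal (𝓞 K))⁰) :
    galClass σ (ClassGroup.mk0 I) = ClassGroup.mk0 (galIdeal σ I) := by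
  let f := RingOfIntegers.mapRingEquiv (σ : K ≃+* K)
  let F := FractionRing (𝓞 K)
  have key : Units.mapEquiv (FractionalIdeal.ringEquivOfRingEquiv F F f).toMulEquiv
      (FractionalIdeal.mk0 F I) = FractionalIdeal.mk0 F (galIdeal σ I) := by
    apply Units.ext
    ext x
    change x ∈ Submodule.map _ _ ↔ x ∈ ((((galIdeal σ I : (Ideal (𝓞 K))⁰) : Ideal (𝓞 K)) :
      FractionalIdeal (𝓞 K)⁰ F))
    rw [FractionalIdeal.mem_coeIdeal]
    constructor
    · rintro ⟨y, hy, rfl⟩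
      obtain ⟨z, hz, rfl⟩ := (FractionalIdeal.mem_coeIdeal _).1 hy
      exact ⟨f z, Ideal.mem_map_of_mem _ hz,
        (IsFractionRing.ringEquivOfRingEquiv_algebraMap f z).symm⟩
    · rintro ⟨y, hy, rfl⟩
      obtain ⟨z, hz, rfl⟩ := (Ideal.mem_map_iff_of_surjective f f.surjective).1 hy
      exact ⟨algebraMap _ _ z, (FractionalIdeal.mem_coeIdeal _).2 ⟨z, hz, rfl⟩,
        IsFractionRing.ringEquivOfRingEquiv_algebraMap f z⟩
  apply (ClassGroup.equiv F).injective
  rw [galClass, ClassGroup.mulEquiv, MulEquiv.trans_apply, MulEquiv.trans_apply,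
    MulEquiv.apply_symm_apply, ClassGroup.equiv_mk0, ClassGroup.equiv_mk0]
  exact congrArg (QuotientGroup.mk' (toPrincipalIdeal (𝓞 K) F).range) key

variable (p : ℕ) [Fact p.Prime] [IsCyclotomicExtension {p} ℚ K]

variable (K) in
/-- Complex conjugation on `K = ℚ(ζ_p)`: the automorphism with `ζ ↦ ζ⁻¹`. -/
def conj : Gal(K/ℚ) :=
  (IsCyclotomicExtension.Rat.galEquivZMod p K).symm (-1)

/-- `conj` is complex conjugation under every embedding of `K` into `ℂ`. -/
theorem embedding_conj (φ : K →+* ℂ) (x : K) :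
    φ (conj K p x) = (starRingEnd ℂ) (φ x) := by
  have hζ := IsCyclotomicExtension.zeta_spec p ℚ K
  have hp : p ≠ 0 := (Fact.out : p.Prime).ne_zero
  set ζ := IsCyclotomicExtension.zeta p ℚ K
  have h1 : conj K p ζ * ζ = 1 := by
    rw [IsCyclotomicExtension.Rat.galEquivZMod_apply_of_pow_eq p K _ hζ.pow_eq_one, conj,
      MulEquiv.apply_symm_apply, ← pow_succ, hζ.pow_eq_one_iff_dvd, ← ZMod.natCast_eq_zero_iff]
    simp
  have h2 : φ (conj K p ζ) = (starRingEnd ℂ) (φ ζ) := by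
    have h3 : (starRingEnd ℂ) (φ ζ) * φ ζ = 1 := by
      have hn : ‖φ ζ‖ = 1 :=
        Complex.norm_eq_one_of_pow_eq_one (by rw [← map_pow, hζ.pow_eq_one, map_one]) hp
      rw [mul_comm, Complex.mul_conj, Complex.normSq_eq_norm_sq, hn]
      simp
    have h4 : φ (conj K p ζ) * φ ζ = 1 := by rw [← map_mul, h1, map_one]
    have h5 : φ ζ ≠ 0 := right_ne_zero_of_mul_eq_one h4
    exact mul_right_cancel₀ h5 (h4.trans h3.symm)
  let f : K →ₐ[ℚ] ℂ := (φ.comp (conj K p : K →+* K)).toRatAlgHom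
  let g : K →ₐ[ℚ] ℂ := ((starRingEnd ℂ).comp φ).toRatAlgHom
  have hfg : f = g := (hζ.powerBasis ℚ).algHom_ext (by simpa [f, g] using h2)
  exact DFunLike.congr_fun hfg x

variable (K) in
/-- `C_p`: the classes of exponent `p` in the class group of `K = ℚ(ζ_p)`. -/
def classExpP : Subgroup (ClassGroup (𝓞 K)) :=
  (powMonoidHom p : ClassGroup (𝓞 K) →* ClassGroup (𝓞 K)).ker

variable (K) in
/-- `C_p⁻`, the relative part of `C_p = C_p⁺ ⊕ C_p⁻`: the classes `c` in `C_p` which complex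
conjugation inverts, that is `c * c̄ = 1`. For odd `p` it maps isomorphically to `C_p / C_p⁺`. -/
def classMinus : Subgroup (ClassGroup (𝓞 K)) :=
  classExpP K p ⊓
    (MonoidHom.id (ClassGroup (𝓞 K)) * (galClass (conj K p)).toMonoidHom).ker

/-- The prime ideal `π = (1 - ζ)ℤ[ζ]`. -/
def primePi {ζ : K} (hζ : IsPrimitiveRoot ζ p) : Ideal (𝓞 K) :=
  Ideal.span {1 - hζ.toInteger}

/-- `π ^ n ∣ x`, i.e. `x ≡ 0 mod π ^ n`, for an element `x` of `K`: `x = a / s` with `a, s ∈ ℤ[ζ]`,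
`a ∈ π ^ n` and `s ∉ π`. -/
def PiPowDvd {ζ : K} (hζ : IsPrimitiveRoot ζ p) (n : ℕ) (x : K) : Prop :=
  ∃ a s : 𝓞 K, a ∈ primePi p hζ ^ n ∧ s ∉ primePi p hζ ∧ (s : K) * x = a

/-- `π ^ n ∥ x`: `π ^ n` divides `x` and `π ^ (n + 1)` does not. -/
def PiPowExact {ζ : K} (hζ : IsPrimitiveRoot ζ p) (n : ℕ) (x : K) : Prop :=
  PiPowDvd p hζ n x ∧ ¬ PiPowDvd p hζ (n + 1) x

/-- `x ∈ K` is singular: `xℤ[ζ]` is the `p`-th power of a non-principal fractional ideal. -/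
def IsSingular (x : K) : Prop :=
  ∃ J : (FractionalIdeal (𝓞 K)⁰ K)ˣ, ClassGroup.mk K J ≠ 1 ∧
    FractionalIdeal.spanSingleton (𝓞 K)⁰ x = (J : FractionalIdeal (𝓞 K)⁰ K) ^ p

/-- `x ∈ K` is primary: `x ≡ c ^ p mod π ^ p` for an integer `c` prime to `p`. -/
def IsPrimary {ζ : K} (hζ : IsPrimitiveRoot ζ p) (x : K) : Prop :=
  ∃ c : ℤ, ¬ (p : ℤ) ∣ c ∧ PiPowDvd p hζ p (x - (c : K) ^ p)

end

end CycloSingular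

/-!
The eigenvalue `μ` of `σ` on the class `c` of `b` is an odd power `u ^ k` because complex conjugation
is the `(p - 1) / 2`-th power of `σ` and inverts `c`. The exponent `k = 1` is excluded by
Stickelberger's relation. For a prime `𝔮` with trivial stabilizer in the Galois group, the Jacobi
sums `J(χ, χ ^ j)` of the `p`-th power residue character `χ` modulo `𝔮` generate products of
conjugates of `𝔮`, which can be read off from the reduction of the Jacobi sums modulo `𝔮`;
multiplying over all `j ≠ -1` gives a generator of `∏ σ_a⁻¹(𝔮) ^ (p - 1 - a)`
(`stickelberger_relation`). The projection onto the eigenspace `σ_a ↦ a` of the `p`-part of the class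
group kills the class of every prime: for primes with a nontrivial stabilizer because the character
is nontrivial on it, for the others because the projection sends the Stickelberger element to a
`p`-adic unit (`eigenclass_eq_one`). So that eigenspace is trivial, which leaves
`k = 2 m + 1 ≥ 3` (`exists_eigenvalue_eq_pow`).

Now let `B` generate `b ^ p` and put `C = B / B̄`. As `σ(b)` lies in the class of `b ^ μ`, and the
quotient of a unit by its conjugate is `±ζ ^ i` by Kummer's lemma, `σ(C) = C ^ μ β ^ p ζ ^ i` with
`β β̄ = 1` (`galois_div_conj`). Since `μ ≠ u`, multiplying `B` by a power of `ζ` makes `ζ ^ i`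
disappear; it is already absent when `C ≡ 1 mod π ^ 2`. As `C ≡ 1 mod π`, the factor `β ^ p` is `1`
modulo `π ^ p`, so `σ(C) ≡ C ^ μ mod π ^ p`. If `π ^ j` exactly divides `C - 1` with `j < p`, comparing
the coefficients of `(1 - ζ) ^ j` yields `u ^ j = μ`, that is `j = 2 m + 1`
(`pow_succ_dvd_sub_one_of_ne`). Hence `C - 1` is divisible by `π ^ (2 m + 1)`, and either exactly so
or even by `π ^ p`. An element which is `1` modulo `π` is primary only if it is `1` modulo `π ^ p`, so
these two cases are the nonprimary and the primary one.
-/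

namespace CycloSingular

/-! ### Group actions and the eigenspace of the tautological character -/

section GroupAction

variable {p : ℕ} [hp : Fact p.Prime] {A : Type*} [CommGroup A]

theorem eq_one_of_pow_prime_pow_eq_one {x : A} {N k : ℕ} (hx : x ^ p ^ N = 1)
    (hk : (k : ZMod p) ≠ 0) (h : x ^ k = 1) : x = 1 := by
  have hc : Nat.Coprime (p ^ N) k :=
    Nat.Coprime.pow_left _ ((hp.out.coprime_iff_not_dvd).2 fun hd ↦
      hk ((ZMod.natCast_eq_zero_iff _ _).2 hd))
  exact orderOf_eq_one_iff.1 (Nat.dvd_one.1 (hc ▸ Nat.dvd_gcd (orderOf_dvd_of_pow_eq_one hx)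
    (orderOf_dvd_of_pow_eq_one h)))

/-- An approximation modulo `p ^ (N + 1)` of the Teichmüller lift of `a`. -/
def teichLift (N : ℕ) (a : (ZMod p)ˣ) : ℕ := (a : ZMod p).val ^ p ^ N

theorem teichLift_cast (N : ℕ) (a : (ZMod p)ˣ) : (teichLift N a : ZMod p) = a := by
  simp [teichLift, ZMod.pow_card_pow]

theorem teichLift_mul (N : ℕ) (a b : (ZMod p)ˣ) :
    teichLift N (a * b) ≡ teichLift N a * teichLift N b [MOD p ^ N] := by
  have h : ((p : ℕ) : ℤ) ∣ ((a * b : (ZMod p)ˣ) : ZMod p).val -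
      ((a : ZMod p).val * (b : ZMod p).val : ℤ) := by
    rw [← ZMod.intCast_eq_intCast_iff_dvd_sub]
    simp
  have h2 := dvd_sub_pow_of_dvd_sub h N
  rw [mul_pow] at h2
  refine Nat.ModEq.symm ((Nat.modEq_iff_dvd).2 ?_)
  have h3 := (pow_dvd_pow (p : ℤ) (Nat.le_succ N)).trans h2
  simpa [teichLift] using h3

variable [Finite A] (φ : (ZMod p)ˣ →* MulAut A)

/-- If a class `c` with `c ^ p = 1` lies in the eigenspace of the tautological character of
`(ℤ/p)ˣ`, it is trivial as soon as the group is generated by elements which either have a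
nontrivial stabilizer, or are killed by the Stickelberger element `∑ (p - 1 - a) [a⁻¹]`. The
projection onto the eigenspace in the `p`-part kills the generators of the first kind because the
character is nontrivial on the stabilizer, and those of the second kind because it sends the
Stickelberger element to a unit modulo `p`. -/
theorem eigenclass_eq_one (hp2 : p ≠ 2) (S : Set A) (hS : Subgroup.closure S = ⊤)
    (h : ∀ s ∈ S, (∃ b : (ZMod p)ˣ, b ≠ 1 ∧ φ b s = s) ∨
      ∏ a : (ZMod p)ˣ, φ a⁻¹ s ^ (p - 1 - (a : ZMod p).val) = 1)
    (c : A) (hc : c ^ p = 1) (hφ : ∀ a : (ZMod p)ˣ, φ a c = c ^ (a : ZMod p).val) : c = 1 := by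
  obtain ⟨N, M, hM, hcard⟩ := Nat.exists_eq_pow_mul_and_not_dvd
    (Nat.card_pos (α := A)).ne' p hp.out.ne_one
  -- The `M`-th powers have exponent `p ^ N`, so on them `teichLift N a⁻¹` matters only modulo
  -- `p ^ N`, where `teichLift N` is multiplicative.
  let E : A →* A := ∏ a : (ZMod p)ˣ,
    (powMonoidHom (teichLift N a⁻¹ * M)).comp (φ a).toMonoidHom
  have hE : ∀ x, E x = ∏ a : (ZMod p)ˣ, φ a x ^ (teichLift N a⁻¹ * M) := fun x ↦ by
    simp [E]
  have hMN : ∀ x : A, (x ^ M) ^ p ^ N = 1 := fun x ↦ by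
    rw [← pow_mul, mul_comm, ← hcard, pow_card_eq_one']
  have hEN : ∀ x, E x ^ p ^ N = 1 := fun x ↦ by
    rw [hE, ← Finset.prod_pow]
    refine Finset.prod_eq_one fun a _ ↦ ?_
    rw [mul_comm, pow_mul, pow_right_comm, hMN, one_pow]
  have hEφ : ∀ b x, E (φ b x) = E x ^ teichLift N b := fun b x ↦ by
    rw [hE, hE, ← Finset.prod_pow, ← Equiv.prod_comp (Equiv.mulRight b)]
    conv_rhs => rw [← Equiv.prod_comp (Equiv.mulRight b)]
    rw [← Equiv.prod_comp (Equiv.mulRight b⁻¹)]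
    refine Finset.prod_congr rfl fun a _ ↦ ?_
    simp only [Equiv.coe_mulRight, inv_mul_cancel_right]
    rw [← MulAut.mul_apply, ← map_mul, mul_comm (teichLift N _) M, mul_comm (teichLift N _) M,
      pow_mul, pow_mul, ← pow_mul (_ ^ M)]
    refine pow_eq_pow_of_modEq ?_ (hMN _)
    rw [mul_comm]
    simpa using (teichLift_mul N b (a * b)⁻¹)
  have hES : ∀ s ∈ S, E s = 1 := by
    intro s hs
    rcases h s hs with ⟨b, hb, hbs⟩ | hst
    · have h1 : 1 ≤ teichLift N b := Nat.one_le_iff_ne_zero.2 fun h0 ↦ by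
        have := teichLift_cast N b
        rw [h0, Nat.cast_zero] at this
        exact b.ne_zero this.symm
      have h2 := hEφ b s
      rw [hbs] at h2
      refine eq_one_of_pow_prime_pow_eq_one (hEN s) (k := teichLift N b - 1) ?_ ?_
      · rw [Nat.cast_sub h1, teichLift_cast, Nat.cast_one, sub_ne_zero]
        exact fun h ↦ hb (Units.ext h)
      · rw [← mul_right_inj (E s), mul_one, mul_pow_sub_one (by lia), ← h2]
    · have h1 := congrArg E hst
      simp only [map_prod, map_pow, map_one, hEφ] at h1
      simp only [← pow_mul, Finset.prod_pow_eq_pow_sum] at h1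
      refine eq_one_of_pow_prime_pow_eq_one (hEN s) ?_ h1
      have hle : ∀ a : (ZMod p)ˣ, (a : ZMod p).val ≤ p - 1 := fun a ↦
        Nat.le_sub_one_of_lt (ZMod.val_lt _)
      have hsum : ∀ a : (ZMod p)ˣ, ((a⁻¹ : (ZMod p)ˣ) : ZMod p) * ((p - 1 : ℕ) - a)
          = - ((a⁻¹ : (ZMod p)ˣ) : ZMod p) - 1 := fun a ↦ by
        rw [Nat.cast_sub hp.out.one_le, ZMod.natCast_self, Nat.cast_one, mul_sub, Units.inv_mul]
        ring
      have hinv : ∑ a : (ZMod p)ˣ, ((a⁻¹ : (ZMod p)ˣ) : ZMod p) = 0 := by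
        rw [show ∑ a : (ZMod p)ˣ, ((a⁻¹ : (ZMod p)ˣ) : ZMod p) = ∑ a : (ZMod p)ˣ, (a : ZMod p) from
          Equiv.sum_comp (Equiv.inv _) (fun a : (ZMod p)ˣ ↦ (a : ZMod p))]
        have h3 := FiniteField.sum_pow_units (ZMod p) 1
        have h4 : ¬ (p - 1 ∣ 1) := by
          have := hp.out.two_le
          rw [Nat.dvd_one]
          lia
        simpa only [pow_one, ZMod.card, if_neg h4] using h3
      have hcast : ∀ a : (ZMod p)ˣ, ((teichLift N a⁻¹ * (p - 1 - (a : ZMod p).val) : ℕ) : ZMod p)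
          = - ((a⁻¹ : (ZMod p)ˣ) : ZMod p) - 1 := fun a ↦ by
        rw [Nat.cast_mul, teichLift_cast, Nat.cast_sub (hle a), ZMod.natCast_val, ZMod.cast_id',
          id, hsum]
      rw [Nat.cast_sum, Finset.sum_congr rfl fun a _ ↦ hcast a, Finset.sum_sub_distrib,
        Finset.sum_neg_distrib, hinv, Finset.sum_const, Finset.card_univ, ZMod.card_units,
        nsmul_eq_mul, Nat.cast_sub hp.out.one_le, ZMod.natCast_self]
      simp
  have hE1 : ∀ x, E x = 1 := by
    intro x
    have : Subgroup.closure S ≤ E.ker := (Subgroup.closure_le _).2 hES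
    exact this (hS ▸ Subgroup.mem_top x)
  have h1 := hE1 c
  simp only [hE, hφ, ← pow_mul, Finset.prod_pow_eq_pow_sum] at h1
  refine eq_one_of_pow_prime_pow_eq_one (N := 1) (by simpa using hc) ?_ h1
  have hcast : ∀ a : (ZMod p)ˣ, (((a : ZMod p).val * (teichLift N a⁻¹ * M) : ℕ) : ZMod p) = M :=
    fun a ↦ by
      rw [Nat.cast_mul, Nat.cast_mul, teichLift_cast, ZMod.natCast_val, ZMod.cast_id', id,
        ← mul_assoc, Units.mul_inv, one_mul]
  rw [Nat.cast_sum, Finset.sum_congr rfl fun a _ ↦ hcast a, Finset.sum_const, Finset.card_univ,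
    ZMod.card_units, nsmul_eq_mul, Nat.cast_sub hp.out.one_le, ZMod.natCast_self, Nat.cast_one,
    zero_sub, neg_one_mul, neg_ne_zero, Ne, ZMod.natCast_eq_zero_iff]
  exact hM

end GroupAction

/-! ### Jacobi sums of power residue characters -/

section JacobiSum

variable {p : ℕ} {R F : Type*} [CommRing R] [Field F] [Fintype F]

/-- The `p`-th power residue character: `χ` has values in the `p`-th roots of unity of `R`, and
reduces to `x ↦ x ^ ((#F - 1) / p)` in the residue field `F`. -/
theorem exists_powerResidueChar [hp : Fact p.Prime] (f : R →+* F) {ζ : R} (hζ : ζ ^ p = 1)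
    (hζF : IsPrimitiveRoot (f ζ) p) :
    ∃ χ : MulChar F R, ∃ k : ℕ, k * p = Fintype.card F - 1 ∧ χ ^ p = 1 ∧
      ∀ x, f (χ x) = x ^ k := by
  classical
  have hp0 : p ≠ 0 := hp.out.ne_zero
  obtain ⟨g, hg⟩ := IsCyclic.exists_generator (α := Fˣ)
  have hdvd : p ∣ Fintype.card Fˣ := by
    have := hζF.isUnit hp0
    rw [hζF.eq_orderOf, ← this.unit_spec, orderOf_units]
    exact orderOf_dvd_card
  obtain ⟨k, hk⟩ := hdvd
  have hk0 : k ≠ 0 := by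
    rintro rfl
    exact Fintype.card_ne_zero (α := Fˣ) (by simp [hk])
  obtain ⟨i, -, hi⟩ := hζF.eq_pow_of_pow_eq_one (ξ := (g : F) ^ k) (by
    rw [← pow_mul, mul_comm, ← hk, ← Units.val_pow_eq_pow_val, pow_card_eq_one, Units.val_one])
  let z : Rˣ := Units.ofPowEqOne ζ p hζ hp0 ^ i
  have hzp : z ^ p = 1 := by
    rw [pow_right_comm, Units.pow_ofPowEqOne, one_pow]
  have hz : z ∈ rootsOfUnity (Fintype.card Fˣ) R := by
    rw [mem_rootsOfUnity, hk, pow_mul, hzp, one_pow]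
  let χ := MulChar.ofRootOfUnity hz hg
  have hχg : χ g = z := MulChar.ofRootOfUnity_spec hz hg
  refine ⟨χ, k, by rw [mul_comm, ← hk, Fintype.card_units], ?_, fun x ↦ ?_⟩
  · rw [MulChar.eq_iff hg, MulChar.pow_apply_coe, hχg, ← Units.val_pow_eq_pow_val, hzp]
    simp
  · by_cases hx : x = 0
    · rw [hx, MulChar.map_zero, map_zero, zero_pow hk0]
    · obtain ⟨n, hn⟩ := (Submonoid.mem_powers_iff _ _).1
        (mem_powers_iff_mem_zpowers.2 (hg (Units.mk0 x hx)))
      have hx' : x = (g : F) ^ n := by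
        rw [← Units.val_pow_eq_pow_val, hn, Units.val_mk0]
      rw [hx', map_pow, map_pow, hχg, ← pow_mul, mul_comm n, pow_mul, ← hi]
      simp [z]

variable {f : R →+* F} {χ : MulChar F R} {k : ℕ}

/-- Modulo the residue field, `J(χ ^ a, χ ^ b)` is the sum over `F` of the polynomial
`X ^ (k a) (1 - X) ^ (k b)`, which has degree less than `#F - 1`. -/
theorem jacobiSum_pow_mem_ker (hkp : k * p = Fintype.card F - 1)
    (hχ : ∀ x, f (χ x) = x ^ k) {a b : ℕ} (ha : a ≠ 0) (hb : b ≠ 0) (hab : a + b < p) :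
    f (jacobiSum (χ ^ a) (χ ^ b)) = 0 := by
  have h1 : ∀ x : F, f ((χ ^ a) x * (χ ^ b) (1 - x)) = x ^ (k * a) * (1 - x) ^ (k * b) :=
    fun x ↦ by
      rw [map_mul, MulChar.pow_apply' _ ha, MulChar.pow_apply' _ hb, map_pow, map_pow, hχ, hχ,
        pow_mul, pow_mul]
  have hk : 0 < k := Nat.pos_of_ne_zero fun h ↦ by
    have := Fintype.one_lt_card (α := F)
    rw [h] at hkp
    lia
  rw [jacobiSum, map_sum, Finset.sum_congr rfl fun x _ ↦ h1 x]
  simp_rw [sub_eq_neg_add, add_pow, Finset.mul_sum, one_pow, mul_one]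
  rw [Finset.sum_comm]
  refine Finset.sum_eq_zero fun m hm ↦ ?_
  have hm' : k * a + m < Fintype.card F - 1 := by
    have h2 := Finset.mem_range.1 hm
    have h3 : k * (a + b) < k * p := Nat.mul_lt_mul_of_pos_left hab hk
    rw [mul_add] at h3
    lia
  have h4 : ∀ x : F, x ^ (k * a) * ((-x) ^ m * ((k * b).choose m : F)) =
      ((-1) ^ m * ((k * b).choose m : F)) * x ^ (k * a + m) := fun x ↦ by
    rw [neg_pow x, pow_add]
    ring
  rw [Finset.sum_congr rfl fun x _ ↦ h4 x, ← Finset.mul_sum,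
    FiniteField.sum_pow_lt_card_sub_one F _ hm', mul_zero]

theorem powerResidueChar_pow_ne_one (hkp : k * p = Fintype.card F - 1)
    (hχ : ∀ x, f (χ x) = x ^ k) {a : ℕ} (ha : a ≠ 0) (hap : a < p) : χ ^ a ≠ 1 := by
  classical
  intro h
  have hk : 0 < k := Nat.pos_of_ne_zero fun h ↦ by
    have := Fintype.one_lt_card (α := F)
    rw [h] at hkp
    lia
  obtain ⟨g, hg⟩ := IsCyclic.exists_generator (α := Fˣ)
  have h1 : (g : F) ^ (k * a) = 1 := by
    rw [pow_mul, ← hχ, ← map_pow, ← MulChar.pow_apply' _ ha, h]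
    simp
  have h2 : g ^ (k * a) = 1 := Units.ext (by simpa using h1)
  have h3 := Nat.le_of_dvd (Nat.mul_pos hk (Nat.pos_of_ne_zero ha)) (orderOf_dvd_of_pow_eq_one h2)
  rw [orderOf_eq_card_of_forall_mem_zpowers hg, Nat.card_eq_fintype_card, Fintype.card_units,
    ← hkp] at h3
  exact absurd (Nat.le_of_mul_le_mul_left h3 hk) (by lia)

theorem jacobiSum_pow_mul_jacobiSum_pow [IsDomain R] [CharZero R] (hkp : k * p = Fintype.card F - 1)
    (hχ : ∀ x, f (χ x) = x ^ k) (hχp : χ ^ p = 1) {a b : ℕ} (ha : a ≠ 0) (hap : a < p) (hb : b ≠ 0)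
    (hbp : b < p) (hab : a + b ≠ p) :
    jacobiSum (χ ^ a) (χ ^ b) * jacobiSum (χ ^ (p - a)) (χ ^ (p - b)) = Fintype.card F := by
  let L := FractionRing R
  let i := algebraMap R L
  have hi : Function.Injective i := IsFractionRing.injective R L
  have hinv : ∀ n ≤ p, χ ^ (p - n) = (χ ^ n)⁻¹ := fun n hn ↦ by
    rw [eq_inv_iff_mul_eq_one, ← pow_add, Nat.sub_add_cancel hn, hχp]
  have hne : ∀ n, n ≠ 0 → n < p → (χ ^ n).ringHomComp i ≠ 1 := fun n h0 hn ↦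
    (MulChar.ringHomComp_ne_one_iff hi).2 (powerResidueChar_pow_ne_one hkp hχ h0 hn)
  have hab' : χ ^ (a + b) ≠ 1 := by
    rcases lt_or_gt_of_ne hab with h | h
    · exact powerResidueChar_pow_ne_one hkp hχ (by lia) h
    · rw [show a + b = (a + b - p) + p by lia, pow_add, hχp, mul_one]
      exact powerResidueChar_pow_ne_one hkp hχ (by lia) (by lia)
  apply hi
  rw [map_mul, ← jacobiSum_ringHomComp, ← jacobiSum_ringHomComp, hinv a hap.le, hinv b hbp.le,
    map_natCast, ← MulChar.ringHomComp_inv, ← MulChar.ringHomComp_inv]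
  have : CharZero L := charZero_of_injective_algebraMap hi
  refine jacobiSum_mul_jacobiSum_inv ?_ (hne a ha hap) (hne b hb hbp) ?_
  · rw [ringChar.eq_zero]
    exact (CharP.ringChar_ne_zero_of_finite F).symm
  · rw [← MulChar.ringHomComp_mul, ← pow_add]
    exact (MulChar.ringHomComp_ne_one_iff hi).2 hab'

end JacobiSum

/-! ### Galois action on ideals and products of conjugate primes -/

section Factorization

variable {K : Type*} [Field K] [NumberField K]

/-- The automorphism of `𝓞 K` induced by `σ`. -/
abbrev galRing (σ : Gal(K/ℚ)) : 𝓞 K ≃+* 𝓞 K := RingOfIntegers.mapRingEquiv (σ : K ≃+* K)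

theorem coe_galRing (σ : Gal(K/ℚ)) (x : 𝓞 K) : (galRing σ x : K) = σ x := rfl

theorem galRing_mul_apply (σ τ : Gal(K/ℚ)) (x : 𝓞 K) :
    galRing (σ * τ) x = galRing σ (galRing τ x) := rfl

theorem galRing_one_apply (x : 𝓞 K) : galRing (1 : Gal(K/ℚ)) x = x := rfl

theorem galRing_inv_apply_self (σ : Gal(K/ℚ)) (x : 𝓞 K) : galRing σ⁻¹ (galRing σ x) = x := by
  rw [← galRing_mul_apply, inv_mul_cancel, galRing_one_apply]

theorem galRing_apply_inv_self (σ : Gal(K/ℚ)) (x : 𝓞 K) : galRing σ (galRing σ⁻¹ x) = x := by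
  rw [← galRing_mul_apply, mul_inv_cancel, galRing_one_apply]

theorem mem_map_galRing (σ : Gal(K/ℚ)) (I : Ideal (𝓞 K)) (x : 𝓞 K) :
    x ∈ I.map (galRing σ) ↔ galRing σ⁻¹ x ∈ I := by
  rw [Ideal.mem_map_of_equiv]
  constructor
  · rintro ⟨y, hy, rfl⟩
    rwa [galRing_inv_apply_self]
  · exact fun h ↦ ⟨_, h, galRing_apply_inv_self σ x⟩

theorem map_galRing_mul (σ τ : Gal(K/ℚ)) (I : Ideal (𝓞 K)) :
    I.map (galRing (σ * τ)) = (I.map (galRing τ)).map (galRing σ) := by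
  ext x
  simp only [mem_map_galRing, mul_inv_rev, galRing_mul_apply]

theorem map_galRing_one (I : Ideal (𝓞 K)) : I.map (galRing (1 : Gal(K/ℚ))) = I := by
  ext x
  simp only [mem_map_galRing, inv_one, galRing_one_apply]

theorem absNorm_map_galRing (σ : Gal(K/ℚ)) (I : Ideal (𝓞 K)) :
    (I.map (galRing σ)).absNorm = I.absNorm := by
  rw [Ideal.absNorm_apply, Ideal.absNorm_apply]
  exact (Nat.card_congr (Ideal.quotientEquiv I _ (galRing σ) rfl).toEquiv).symm

/-- If distinct maximal ideals have product `(x * y)`, and those indexed by `S` contain `x` while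
the others contain `y`, then those indexed by `S` have product `(x)`: both partial products divide
`(x)` and `(y)`, and no room is left. -/
theorem span_eq_prod_of_span_mul_eq_prod {ι : Type*} [Fintype ι] {Q : ι → Ideal (𝓞 K)}
    (hQ : ∀ i, (Q i).IsMaximal) (hinj : Function.Injective Q) {x y : 𝓞 K} (hxy : x * y ≠ 0)
    (hprod : ∏ i, Q i = Ideal.span {x * y}) (S : Finset ι) (hx : ∀ i ∈ S, x ∈ Q i)
    (hy : ∀ i ∉ S, y ∈ Q i) : Ideal.span {x} = ∏ i ∈ S, Q i := by
  classical
  have key : ∀ (z : 𝓞 K) (T : Finset ι), (∀ i ∈ T, z ∈ Q i) → ∏ i ∈ T, Q i ∣ Ideal.span {z} :=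
    fun z T h ↦ Finset.prod_dvd_of_coprime
      (fun i _ j _ hij ↦ by
        have := hQ i
        have := hQ j
        exact Ideal.isCoprime_of_isMaximal (hinj.ne hij))
      (fun i hi ↦ Ideal.dvd_span_singleton.2 (h i hi))
  obtain ⟨U, hU⟩ := key x S hx
  obtain ⟨V, hV⟩ := key y Sᶜ fun i hi ↦ hy i (Finset.mem_compl.1 hi)
  have h0 : (∏ i, Q i) ≠ 0 := by
    rw [hprod]
    simpa using hxy
  have h1 : (∏ i, Q i) * (U * V) = (∏ i, Q i) * 1 := by
    rw [mul_one]
    conv_rhs => rw [hprod, ← Ideal.span_singleton_mul_span_singleton, hU, hV]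
    rw [← Finset.prod_mul_prod_compl S]
    ring
  have h2 : U = 1 := by
    have := Ideal.isUnit_iff.1 (IsUnit.of_mul_eq_one V (mul_left_cancel₀ h0 h1))
    rw [this, Ideal.one_eq_top]
  rw [hU, h2, mul_one]

/-- As many distinct maximal ideals of norm `n` as the degree of `K` have product `(n)`: each of them
contains `n`, so the product divides `(n)`, and the norms agree. -/
theorem prod_eq_span_of_absNorm {ι : Type*} [Fintype ι] {Q : ι → Ideal (𝓞 K)}
    (hQ : ∀ i, (Q i).IsMaximal) (hinj : Function.Injective Q) {n : ℕ} (hn : n ≠ 0)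
    (hcard : Fintype.card ι = Module.finrank ℚ K) (hnorm : ∀ i, (Q i).absNorm = n) :
    ∏ i, Q i = Ideal.span {(n : 𝓞 K)} := by
  obtain ⟨U, hU⟩ : ∏ i, Q i ∣ Ideal.span {(n : 𝓞 K)} := Finset.prod_dvd_of_coprime
      (fun i _ j _ hij ↦ by
        have := hQ i
        have := hQ j
        exact Ideal.isCoprime_of_isMaximal (hinj.ne hij))
      (fun i hi ↦ Ideal.dvd_span_singleton.2 (hnorm i ▸ Ideal.absNorm_mem (Q i)))
  have h1 := congrArg Ideal.absNorm hU
  rw [map_mul, map_prod, Finset.prod_congr rfl fun i _ ↦ hnorm i, Finset.prod_const,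
    Finset.card_univ, hcard, Ideal.absNorm_span_singleton,
    show (n : 𝓞 K) = algebraMap ℤ (𝓞 K) n by simp, Algebra.norm_algebraMap,
    RingOfIntegers.rank] at h1
  have h2 : U.absNorm = 1 := by
    have h3 : n ^ Module.finrank ℚ K ≠ 0 := pow_ne_zero _ hn
    refine mul_left_cancel₀ h3 ?_
    rw [← h1, mul_one, Int.natAbs_pow, Int.natAbs_natCast]
  rw [hU, Ideal.absNorm_eq_one_iff.1 h2, Ideal.mul_top]

end Factorization

/-! ### Stickelberger's relation -/

section Stickelberger

variable {p : ℕ} [hp : Fact p.Prime] {K : Type*} [Field K] [NumberField K]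
  [IsCyclotomicExtension {p} ℚ K] {ζ : K}

variable (K) in
/-- The automorphism `ζ ↦ ζ ^ a` of `ℚ(ζ_p)`. -/
noncomputable abbrev galOf : (ZMod p)ˣ ≃* Gal(K/ℚ) :=
  (IsCyclotomicExtension.Rat.galEquivZMod p K).symm

theorem galOf_apply_of_pow_eq_one (a : (ZMod p)ˣ) {x : K} (hx : x ^ p = 1) :
    galOf K a x = x ^ (a : ZMod p).val := by
  rw [IsCyclotomicExtension.Rat.galEquivZMod_apply_of_pow_eq p K _ hx, MulEquiv.apply_symm_apply]

theorem val_neg_unit (t : (ZMod p)ˣ) : ((-t : (ZMod p)ˣ) : ZMod p).val = p - (t : ZMod p).val := by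
  rw [Units.val_neg, ZMod.neg_val, if_neg t.ne_zero]

theorem val_unit_pos (t : (ZMod p)ˣ) : 0 < (t : ZMod p).val :=
  Nat.pos_of_ne_zero ((ZMod.val_ne_zero _).2 t.ne_zero)

/-- For given `a`, exactly `p - 1 - a` of the residues `j` satisfy `a + (a j mod p) < p`. -/
theorem card_filter_val_add_val_lt (a : (ZMod p)ˣ) :
    (Finset.univ.filter fun j : (ZMod p)ˣ ↦
      (a : ZMod p).val + ((a * j : (ZMod p)ˣ) : ZMod p).val < p).card = p - 1 - (a : ZMod p).val := by
  have h1 : p - 1 - (a : ZMod p).val = (Finset.Ico 1 (p - (a : ZMod p).val)).card := by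
    rw [Nat.card_Ico]
    lia
  rw [h1]
  refine Finset.card_bij (fun j _ ↦ ((a * j : (ZMod p)ˣ) : ZMod p).val) ?_ ?_ ?_
  · intro j hj
    have := (Finset.mem_filter.1 hj).2
    have := val_unit_pos (a * j)
    exact Finset.mem_Ico.2 (by lia)
  · intro i _ j _ hij
    exact mul_left_cancel (Units.ext (ZMod.val_injective p hij))
  · intro v hv
    obtain ⟨hv1, hv2⟩ := Finset.mem_Ico.1 hv
    have hvp : v < p := by lia
    have hv0 : (v : ZMod p) ≠ 0 := fun h ↦
      absurd (Nat.le_of_dvd (by lia) ((ZMod.natCast_eq_zero_iff _ _).1 h)) (by lia)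
    refine ⟨a⁻¹ * Units.mk0 _ hv0, ?_, ?_⟩
    · simp only [Finset.mem_filter, Finset.mem_univ, true_and, mul_inv_cancel_left, Units.val_mk0,
        ZMod.val_natCast_of_lt hvp]
      lia
    · simp only [mul_inv_cancel_left, Units.val_mk0, ZMod.val_natCast_of_lt hvp]

theorem galRing_galOf_mulChar {F : Type*} [Field F] {χ : MulChar F (𝓞 K)} (hχp : χ ^ p = 1)
    (a j : (ZMod p)ˣ) (x : F) :
    galRing (galOf K a) ((χ ^ (j : ZMod p).val) x) =
      (χ ^ ((a * j : (ZMod p)ˣ) : ZMod p).val) x := by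
  have hpow : ∀ m n : ℕ, m ≡ n [MOD p] → χ ^ m = χ ^ n := fun m n h ↦ pow_eq_pow_of_modEq h hχp
  have h1 : χ ^ ((a * j : (ZMod p)ˣ) : ZMod p).val =
      (χ ^ (j : ZMod p).val) ^ (a : ZMod p).val := by
    rw [← pow_mul]
    refine hpow _ _ ((ZMod.natCast_eq_natCast_iff _ _ _).1 ?_)
    simp [mul_comm]
  rw [h1]
  set ψ := χ ^ (j : ZMod p).val with hψ
  have hψp : ψ ^ p = 1 := by rw [hψ, pow_right_comm, hχp, one_pow]
  rw [MulChar.pow_apply' _ (val_unit_pos a).ne']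
  by_cases hx : x = 0
  · rw [hx, MulChar.map_zero, map_zero, zero_pow (val_unit_pos a).ne']
  · apply RingOfIntegers.ext
    rw [coe_galRing, galOf_apply_of_pow_eq_one a (x := ((ψ x : 𝓞 K) : K))]
    · simp
    · rw [← map_pow, ← MulChar.pow_apply' _ hp.out.ne_zero, hψp, MulChar.one_apply (by simpa using hx),
        map_one]

theorem galRing_galOf_jacobiSum {F : Type*} [Field F] [Fintype F] {χ : MulChar F (𝓞 K)}
    (hχp : χ ^ p = 1) (a i j : (ZMod p)ˣ) :
    galRing (galOf K a) (jacobiSum (χ ^ (i : ZMod p).val) (χ ^ (j : ZMod p).val)) =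
      jacobiSum (χ ^ ((a * i : (ZMod p)ˣ) : ZMod p).val)
        (χ ^ ((a * j : (ZMod p)ˣ) : ZMod p).val) := by
  simp only [jacobiSum, map_sum, map_mul, galRing_galOf_mulChar hχp]

attribute [local instance] Ideal.Quotient.field in
/-- **Stickelberger's relation** for a prime `𝔮` with trivial stabilizer in the Galois group: the
ideal `∏ σ_a⁻¹(𝔮) ^ (p - 1 - a)` is principal, generated by the product of the Jacobi sums
`J(χ, χ ^ j)` with `j ≠ -1`, for `χ` the `p`-th power residue character modulo `𝔮`. -/
theorem stickelberger_relation (hζ : IsPrimitiveRoot ζ p) (q : Ideal (𝓞 K))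
    [hq : q.IsMaximal] (hq0 : q ≠ ⊥) (hζq : 1 - hζ.toInteger ∉ q)
    (hstab : ∀ b : (ZMod p)ˣ, b ≠ 1 → q.map (galRing (galOf K b)) ≠ q) :
    ∃ x : 𝓞 K, x ≠ 0 ∧
      ∏ a : (ZMod p)ˣ, q.map (galRing (galOf K a⁻¹)) ^ (p - 1 - (a : ZMod p).val) =
        Ideal.span {x} := by
  classical
  have hfin : Finite (𝓞 K ⧸ q) := Ring.HasFiniteQuotients.finiteQuotient hq0
  have := Fintype.ofFinite (𝓞 K ⧸ q)
  let f := Ideal.Quotient.mk q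
  have hfζ : IsPrimitiveRoot (f hζ.toInteger) p := by
    have h1 : f hζ.toInteger ^ p = 1 := by
      rw [← map_pow, hζ.toInteger_isPrimitiveRoot.pow_eq_one, map_one]
    have h2 : f hζ.toInteger ≠ 1 := fun h ↦ hζq (by
      rw [← Ideal.Quotient.eq_zero_iff_mem, map_sub, map_one, sub_eq_zero]
      exact h.symm)
    exact IsPrimitiveRoot.iff_orderOf.2 (orderOf_eq_prime h1 h2)
  obtain ⟨χ, k, hkp, hχp, hχ⟩ := exists_powerResidueChar f
    (hζ.toInteger_isPrimitiveRoot.pow_eq_one) hfζ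
  let Q : (ZMod p)ˣ → Ideal (𝓞 K) := fun a ↦ q.map (galRing (galOf K a⁻¹))
  have hmemQ : ∀ a x, x ∈ Q a ↔ galRing (galOf K a) x ∈ q := fun a x ↦ by
    rw [mem_map_galRing, map_inv, inv_inv]
  have hQ : ∀ a, (Q a).IsMaximal := fun a ↦ Ideal.map_isMaximal_of_equiv _
  have hinj : Function.Injective Q := by
    intro a b hab
    by_contra hne
    refine hstab (a * b⁻¹) (fun h ↦ hne (mul_inv_eq_one.1 h)) ?_
    rw [map_mul, map_galRing_mul]
    change (Q b).map _ = q
    rw [← hab, ← map_galRing_mul, ← map_mul, mul_inv_cancel, map_one, map_galRing_one]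
  have hn0 : q.absNorm ≠ 0 := fun h ↦ hq0 (Ideal.absNorm_eq_zero_iff.1 h)
  have hcardq : Fintype.card (𝓞 K ⧸ q) = q.absNorm := by
    rw [Ideal.absNorm_apply, Submodule.cardQuot_apply, Nat.card_eq_fintype_card]
  have hprod : ∏ a, Q a = Ideal.span {(q.absNorm : 𝓞 K)} :=
    prod_eq_span_of_absNorm hQ hinj hn0 (by
      rw [IsCyclotomicExtension.Rat.finrank p K, ZMod.card_units_eq_totient])
      (fun a ↦ absNorm_map_galRing _ q)
  let J : (ZMod p)ˣ → 𝓞 K := fun j ↦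
    jacobiSum (χ ^ ((1 : (ZMod p)ˣ) : ZMod p).val) (χ ^ (j : ZMod p).val)
  let J' : (ZMod p)ˣ → 𝓞 K := fun j ↦
    jacobiSum (χ ^ ((-1 : (ZMod p)ˣ) : ZMod p).val) (χ ^ ((-j : (ZMod p)ˣ) : ZMod p).val)
  have hval_ne : ∀ a j : (ZMod p)ˣ, j ≠ -1 →
      (a : ZMod p).val + ((a * j : (ZMod p)ˣ) : ZMod p).val ≠ p := fun a j hj h ↦ by
    have h1 : ((a * j : (ZMod p)ˣ) : ZMod p).val = ((-a : (ZMod p)ˣ) : ZMod p).val := by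
      rw [val_neg_unit]
      lia
    have h2 : a * j = a * -1 := by
      rw [mul_neg_one]
      exact Units.ext (ZMod.val_injective p h1)
    exact hj (mul_left_cancel h2)
  have hJJ : ∀ j, j ≠ -1 → J j * J' j = q.absNorm := fun j hj ↦ by
    have h1 := hval_ne 1 j hj
    rw [one_mul] at h1
    rw [← hcardq]
    have h2 := jacobiSum_pow_mul_jacobiSum_pow hkp hχ hχp (val_unit_pos 1).ne' (ZMod.val_lt _)
      (val_unit_pos j).ne' (ZMod.val_lt _) h1
    simpa only [J, J', val_neg_unit] using h2
  have hJne : ∀ j, j ≠ -1 → J j * J' j ≠ 0 := fun j hj ↦ by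
    rw [hJJ j hj]
    exact_mod_cast hn0
  have hmem : ∀ i j : (ZMod p)ˣ, (i : ZMod p).val + (j : ZMod p).val < p →
      jacobiSum (χ ^ (i : ZMod p).val) (χ ^ (j : ZMod p).val) ∈ q := fun i j h ↦
    Ideal.Quotient.eq_zero_iff_mem.1
      (jacobiSum_pow_mem_ker hkp hχ (val_unit_pos i).ne' (val_unit_pos j).ne' h)
  have hspan : ∀ j, j ≠ -1 → Ideal.span {J j} = ∏ a ∈ Finset.univ.filter fun a : (ZMod p)ˣ ↦
      (a : ZMod p).val + ((a * j : (ZMod p)ˣ) : ZMod p).val < p, Q a := fun j hj ↦ by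
    refine span_eq_prod_of_span_mul_eq_prod hQ hinj (hJne j hj) (by rw [hprod, hJJ j hj]) _
      (fun a ha ↦ ?_) (fun a ha ↦ ?_)
    · rw [hmemQ, galRing_galOf_jacobiSum hχp, mul_one]
      exact hmem _ _ (Finset.mem_filter.1 ha).2
    · rw [hmemQ, galRing_galOf_jacobiSum hχp, mul_neg, mul_neg, mul_one]
      refine hmem _ _ ?_
      rw [val_neg_unit, val_neg_unit]
      have h1 := hval_ne a j hj
      have h2 : ¬ (a : ZMod p).val + ((a * j : (ZMod p)ˣ) : ZMod p).val < p := fun h ↦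
        ha (Finset.mem_filter.2 ⟨Finset.mem_univ _, h⟩)
      have h3 := ZMod.val_lt (a : ZMod p)
      have h4 := ZMod.val_lt ((a * j : (ZMod p)ˣ) : ZMod p)
      lia
  refine ⟨∏ j ∈ Finset.univ.erase (-1), J j, Finset.prod_ne_zero_iff.2 fun j hj ↦
    left_ne_zero_of_mul (hJne j (Finset.ne_of_mem_erase hj)), ?_⟩
  rw [← Ideal.prod_span_singleton, Finset.prod_congr rfl fun j hj ↦
    hspan j (Finset.ne_of_mem_erase hj)]
  simp_rw [Finset.prod_filter]
  rw [Finset.prod_comm]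
  refine Finset.prod_congr rfl fun a _ ↦ ?_
  rw [← Finset.prod_filter, Finset.prod_const, ← card_filter_val_add_val_lt a]
  congr 2
  ext j
  simp only [Finset.mem_filter, Finset.mem_univ, true_and, Finset.mem_erase, and_true, iff_and_self]
  -- `j = -1` never satisfies the inequality, as `a + (p - a) = p`.
  rintro h rfl
  rw [mul_neg_one, val_neg_unit] at h
  have := ZMod.val_lt (a : ZMod p)
  lia

end Stickelberger

/-! ### Galois action on the class group -/

section GaloisActionOnClasses

variable {K : Type*} [Field K] [NumberField K]

theorem galClass_mul_apply (σ τ : Gal(K/ℚ)) (c : ClassGroup (𝓞 K)) :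
    galClass (σ * τ) c = galClass σ (galClass τ c) := by
  obtain ⟨I, rfl⟩ := ClassGroup.mk0_surjective c
  rw [galClass_mk0, galClass_mk0, galClass_mk0]
  congr 1
  exact Subtype.ext (map_galRing_mul σ τ I)

theorem galClass_one_apply (c : ClassGroup (𝓞 K)) : galClass (1 : Gal(K/ℚ)) c = c := by
  obtain ⟨I, rfl⟩ := ClassGroup.mk0_surjective c
  rw [galClass_mk0]
  congr 1
  exact Subtype.ext (map_galRing_one (I : Ideal (𝓞 K)))

variable (K) in
/-- The action of the Galois group on the class group, as a homomorphism. -/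
noncomputable def galClassHom : Gal(K/ℚ) →* MulAut (ClassGroup (𝓞 K)) where
  toFun := galClass
  map_one' := MulEquiv.ext galClass_one_apply
  map_mul' σ τ := MulEquiv.ext (galClass_mul_apply σ τ)

theorem closure_mk0_isPrime : Subgroup.closure {c : ClassGroup (𝓞 K) |
    ∃ I : (Ideal (𝓞 K))⁰, (I : Ideal (𝓞 K)).IsPrime ∧ ClassGroup.mk0 I = c} = ⊤ := by
  rw [eq_top_iff]
  rintro c -
  obtain ⟨⟨I, hI⟩, rfl⟩ := ClassGroup.mk0_surjective c
  have hI0 : I ≠ 0 := mem_nonZeroDivisors_iff_ne_zero.1 hI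
  induction I using UniqueFactorizationMonoid.induction_on_prime with
  | h₁ => exact absurd rfl hI0
  | h₂ I hu =>
    have h1 : (⟨I, hI⟩ : (Ideal (𝓞 K))⁰) = 1 := Subtype.ext ((Ideal.isUnit_iff.1 hu).trans
      Ideal.one_eq_top.symm)
    rw [h1, map_one]
    exact one_mem _
  | h₃ I q hI' hq ih =>
    have h1 : (⟨q * I, hI⟩ : (Ideal (𝓞 K))⁰) =
      ⟨q, mem_nonZeroDivisors_iff_ne_zero.2 hq.ne_zero⟩ *
        ⟨I, mem_nonZeroDivisors_iff_ne_zero.2 hI'⟩ := rfl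
    rw [h1, map_mul]
    exact mul_mem (Subgroup.subset_closure ⟨_, Ideal.isPrime_of_prime hq, rfl⟩) (ih _ hI')

end GaloisActionOnClasses

section EigenclassTrivial

variable {p : ℕ} [hp : Fact p.Prime] {K : Type*} [Field K] [NumberField K]
  [IsCyclotomicExtension {p} ℚ K] {ζ : K}

/-- The eigenspace of the `p`-torsion of the class group for the tautological character
`σ_a ↦ a` is trivial. -/
theorem eigenclass_classGroup_eq_one (hp2 : p ≠ 2) (hζ : IsPrimitiveRoot ζ p)
    (c : ClassGroup (𝓞 K)) (hc : c ^ p = 1)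
    (h : ∀ a : (ZMod p)ˣ, galClass (galOf K a) c = c ^ (a : ZMod p).val) : c = 1 := by
  refine eigenclass_eq_one ((galClassHom K).comp (galOf K).toMonoidHom) hp2 _
    closure_mk0_isPrime ?_ c hc h
  rintro _ ⟨q, hq, rfl⟩
  have hq0 : (q : Ideal (𝓞 K)) ≠ ⊥ := nonZeroDivisors.coe_ne_zero q
  have hqm : (q : Ideal (𝓞 K)).IsMaximal := hq.isMaximal hq0
  change (∃ b : (ZMod p)ˣ, b ≠ 1 ∧ galClass (galOf K b) (ClassGroup.mk0 q) = _) ∨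
    ∏ a : (ZMod p)ˣ, galClass (galOf K a⁻¹) (ClassGroup.mk0 q) ^ (p - 1 - (a : ZMod p).val) = 1
  simp only [galClass_mk0]
  by_cases hstab : ∃ b : (ZMod p)ˣ, b ≠ 1 ∧
      (q : Ideal (𝓞 K)).map (galRing (galOf K b)) = q
  · obtain ⟨b, hb, hbq⟩ := hstab
    exact Or.inl ⟨b, hb, congrArg _ (Subtype.ext hbq)⟩
  push Not at hstab
  by_cases hζq : 1 - hζ.toInteger ∈ (q : Ideal (𝓞 K))
  -- The prime above `p` is principal, so every automorphism fixes its class.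
  · have h1 : Prime (1 - hζ.toInteger) := by
      rw [← neg_sub]
      exact hζ.zeta_sub_one_prime'.neg
    have h2 : (Ideal.span {1 - hζ.toInteger}).IsMaximal :=
      ((Ideal.span_singleton_prime h1.ne_zero).2 h1).isMaximal (by simpa using h1.ne_zero)
    have h3 : Ideal.span {1 - hζ.toInteger} = q :=
      h2.eq_of_le hq.ne_top ((Ideal.span_singleton_le_iff_mem _).2 hζq)
    have h4 : ClassGroup.mk0 q = 1 := (ClassGroup.mk0_eq_one_iff q.2).2 ⟨_, h3.symm⟩
    refine Or.inl ⟨-1, fun h ↦ ?_, ?_⟩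
    · have h5 := congrArg Units.val h
      have : Fact (2 < p) := ⟨lt_of_le_of_ne hp.out.two_le hp2.symm⟩
      exact ZMod.neg_one_ne_one h5
    · rw [← galClass_mk0, h4, map_one]
  · right
    obtain ⟨x, -, hx⟩ := stickelberger_relation hζ (q : Ideal (𝓞 K)) hq0 hζq hstab
    have h1 : ((∏ a : (ZMod p)ˣ, galIdeal (galOf K a⁻¹) q ^ (p - 1 - (a : ZMod p).val) :
        (Ideal (𝓞 K))⁰) : Ideal (𝓞 K)) = Ideal.span {x} := by
      rw [← hx, Submonoid.coe_finsetProd]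
      rfl
    have h2 : ClassGroup.mk0 (∏ a : (ZMod p)ˣ,
        galIdeal (galOf K a⁻¹) q ^ (p - 1 - (a : ZMod p).val)) = 1 :=
      (ClassGroup.mk0_eq_one_iff (SetLike.coe_mem _)).2 ⟨x, h1⟩
    simpa only [map_prod, map_pow] using h2

end EigenclassTrivial

/-! ### Congruences modulo powers of a uniformizer -/

section Congruences

variable {R : Type*} [CommRing R]

theorem sq_dvd_one_add_pow_sub (t : R) (n : ℕ) : t ^ 2 ∣ (1 + t) ^ n - 1 - n * t := by
  induction n with
  | zero => simp
  | succ n ih =>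
    have h : (1 + t) ^ (n + 1) - 1 - (n + 1 : ℕ) * t =
        ((1 + t) ^ n - 1 - n * t) * (1 + t) + t ^ 2 * n := by
      push_cast
      ring
    rw [h]
    exact dvd_add (ih.mul_right _) (dvd_mul_right _ _)

theorem dvd_pow_sub_one {l x : R} (h : l ∣ x - 1) (n : ℕ) : l ∣ x ^ n - 1 :=
  h.trans (sub_one_dvd_pow_sub_one x n)

theorem dvd_of_sq_dvd_one_sub_pow_sub_one {p : ℕ} {l : R} [IsDomain R] (hl : l ≠ 0)
    (hint : ∀ n : ℤ, l ∣ (n : R) ↔ (p : ℤ) ∣ n) {i : ℕ}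
    (h : l ^ 2 ∣ (1 - l) ^ i - 1) : p ∣ i := by
  have h1 := sq_dvd_one_add_pow_sub (-l) i
  rw [← sub_eq_add_neg, neg_sq] at h1
  have h2 : l * l ∣ l * i := by
    have : l * i = ((1 - l) ^ i - 1 - i * -l) - ((1 - l) ^ i - 1) := by ring
    rw [this, ← sq]
    exact dvd_sub h1 h
  have h3 := (hint i).1 (by simpa using (mul_dvd_mul_iff_left hl).1 h2)
  exact Int.natCast_dvd_natCast.1 h3

variable {p : ℕ} [hp : Fact p.Prime] {l : R}

/-- Raising `x ≡ 1 mod l` to the `p`-th power gives `1` modulo `l ^ p`, the middle binomial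
coefficients being divisible by `p` and so by `l ^ (p - 1)`. -/
theorem pow_dvd_pow_prime_sub_one (hpl : l ^ (p - 1) ∣ (p : R)) {x : R} (hx : l ∣ x - 1) :
    l ^ p ∣ x ^ p - 1 := by
  obtain ⟨r, hr⟩ := exists_add_pow_prime_eq hp.out (x - 1) 1
  rw [sub_add_cancel, one_pow, mul_one] at hr
  have h : x ^ p - 1 = (x - 1) ^ p + p * (x - 1) * r := by rw [hr]; ring
  rw [h]
  refine dvd_add (pow_dvd_pow_of_dvd hx p) (Dvd.dvd.mul_right ?_ r)
  rw [← Nat.sub_add_cancel hp.out.one_le, pow_succ, Nat.sub_add_cancel hp.out.one_le]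
  exact mul_dvd_mul hpl hx

theorem dvd_sub_one_of_dvd_pow_prime_sub_one (hres : ∀ x : R, ∃ n : ℤ, l ∣ x - n)
    (hint : ∀ n : ℤ, l ∣ (n : R) ↔ (p : ℤ) ∣ n) {x : R} (hx : l ∣ x ^ p - 1) : l ∣ x - 1 := by
  obtain ⟨n, hn⟩ := hres x
  have h1 : l ∣ x ^ p - (n : R) ^ p := hn.trans (sub_dvd_pow_sub_pow x n p)
  have h2 : l ∣ (n : R) ^ p - n := by
    have := (hint (n ^ p - n)).2 ((ZMod.intCast_eq_intCast_iff_dvd_sub _ _ _).1 (by simp))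
    simpa using this
  have h3 : x - 1 = (x ^ p - 1) - (x ^ p - (n : R) ^ p) - ((n : R) ^ p - n) + (x - n) := by ring
  rw [h3]
  exact dvd_add (dvd_sub (dvd_sub hx h1) h2) hn

theorem dvd_map_of_dvd {s : R →+* R} {v : R} (hs : s l = l * v) {n : ℕ} {x : R}
    (h : l ^ n ∣ x) : l ^ n ∣ s x := by
  obtain ⟨y, rfl⟩ := h
  rw [map_mul, map_pow, hs, mul_pow, mul_assoc]
  exact dvd_mul_right _ _

/-- If `c ≡ 1 mod l ^ k` and `s c ≡ c ^ μ mod l ^ (k + 1)`, comparing the coefficients of `l ^ k`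
on both sides, on which `s` acts by `u ^ k`, gives `u ^ k ≡ μ` unless `c ≡ 1 mod l ^ (k + 1)`. -/
theorem pow_succ_dvd_sub_one_of_ne [IsDomain R] (hl : l ≠ 0)
    (hres : ∀ x : R, ∃ n : ℤ, l ∣ x - n) (hint : ∀ n : ℤ, l ∣ (n : R) ↔ (p : ℤ) ∣ n)
    {s : R →+* R} {v : R} {u : ℕ} (hs : s l = l * v) (hv : l ∣ v - u) {c : R} {k μ : ℕ}
    (hk : 1 ≤ k) (hne : (u : ZMod p) ^ k ≠ μ) (hc : l ^ k ∣ c - 1)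
    (hsc : l ^ (k + 1) ∣ s c - c ^ μ) : l ^ (k + 1) ∣ c - 1 := by
  obtain ⟨y, hy⟩ := hc
  obtain ⟨n, y', hy'⟩ := hres y
  have hy2 : y = n + l * y' := by rw [← hy']; ring
  have hc2 : c = 1 + l ^ k * y := by rw [← hy]; ring
  have hs1 : s c = 1 + l ^ k * (v ^ k * s y) := by
    rw [hc2, map_add, map_one, map_mul, map_pow, hs]
    ring
  have h1 : l ^ (k + 1) ∣ c ^ μ - 1 - μ * (l ^ k * y) := by
    rw [hc2]
    refine dvd_trans ?_ (sq_dvd_one_add_pow_sub (l ^ k * y) μ)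
    rw [mul_pow, ← pow_mul]
    exact (pow_dvd_pow l (by lia)).mul_right _
  have h2 : l ^ (k + 1) ∣ l ^ k * (v ^ k * s y - μ * y) := by
    have : l ^ k * (v ^ k * s y - μ * y) = (s c - c ^ μ) + (c ^ μ - 1 - μ * (l ^ k * y)) := by
      rw [hs1]; ring
    rw [this]
    exact dvd_add hsc h1
  rw [pow_succ] at h2
  have h3 : l ∣ v ^ k * s y - μ * y := (mul_dvd_mul_iff_left (pow_ne_zero k hl)).1 h2
  have h4 : l ∣ v ^ k - (u : R) ^ k := hv.trans (sub_dvd_pow_sub_pow v u k)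
  have h5 : l ∣ ((((u : ℤ) ^ k - μ) * n : ℤ) : R) := by
    have : ((((u : ℤ) ^ k - μ) * n : ℤ) : R) = (v ^ k * s y - μ * y) - (v ^ k - (u : R) ^ k) * n
        - l * (v ^ k * v * s y' - μ * y') := by
      rw [hy2, map_add, map_mul, map_intCast, hs]
      push_cast
      ring
    rw [this]
    exact dvd_sub (dvd_sub h3 (h4.mul_right _)) (dvd_mul_right _ _)
  rcases Int.Prime.dvd_mul' hp.out ((hint _).1 h5) with h6 | h6
  · exfalso
    have := (ZMod.intCast_zmod_eq_zero_iff_dvd _ p).2 h6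
    push_cast at this
    exact hne (sub_eq_zero.1 this)
  · have h7 : l ∣ y := by
      rw [hy2]
      exact dvd_add ((hint n).2 h6) (dvd_mul_right _ _)
    rw [hy, pow_succ]
    exact mul_dvd_mul_left _ h7

/-- The congruence `c ≡ 1 mod l ^ k` improves to `l ^ n` as long as `μ` is not one of the powers
`u ^ i` with `k ≤ i < n`. -/
theorem pow_dvd_sub_one_of_le [IsDomain R] (hl : l ≠ 0)
    (hres : ∀ x : R, ∃ n : ℤ, l ∣ x - n) (hint : ∀ n : ℤ, l ∣ (n : R) ↔ (p : ℤ) ∣ n)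
    {s : R →+* R} {v : R} {u : ℕ} (hs : s l = l * v) (hv : l ∣ v - u) {c : R} {μ : ℕ}
    (hsc : l ^ p ∣ s c - c ^ μ) {k n : ℕ} (hk : 1 ≤ k) (hkn : k ≤ n) (hn : n ≤ p)
    (hne : ∀ i, k ≤ i → i < n → (u : ZMod p) ^ i ≠ μ) (hc : l ^ k ∣ c - 1) : l ^ n ∣ c - 1 := by
  induction n, hkn using Nat.le_induction with
  | base => exact hc
  | succ n hkn ih =>
    exact pow_succ_dvd_sub_one_of_ne hl hres hint hs hv (hk.trans hkn) (hne n hkn n.lt_succ_self)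
      (ih (by lia) fun i h1 h2 ↦ hne i h1 (by lia)) ((pow_dvd_pow l hn).trans hsc)

/-- A `p`-th power factor relating elements which are `1` modulo `l` is `1` modulo `l ^ p`. -/
theorem pow_dvd_pow_prime_sub_one_of_eq (hres : ∀ x : R, ∃ n : ℤ, l ∣ x - n)
    (hint : ∀ n : ℤ, l ∣ (n : R) ↔ (p : ℤ) ∣ n) (hpl : l ^ (p - 1) ∣ (p : R)) {a b β : R}
    (ha : l ∣ a - 1) (hb : l ∣ b - 1) (h : a = b * β ^ p) : l ^ p ∣ β ^ p - 1 := by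
  refine pow_dvd_pow_prime_sub_one hpl (dvd_sub_one_of_dvd_pow_prime_sub_one hres hint ?_)
  have : β ^ p - 1 = (a - 1) - (b - 1) * β ^ p := by rw [h]; ring
  rw [this]
  exact dvd_sub ha (hb.mul_right _)

end Congruences

/-! ### The local ring at `π` -/

section Coercions

variable {K : Type*} [Field K]

theorem val_mul (a b : 𝓞 K) : ((a * b : 𝓞 K) : K) = a * b := rfl
theorem val_add (a b : 𝓞 K) : ((a + b : 𝓞 K) : K) = a + b := rfl
theorem val_sub (a b : 𝓞 K) : ((a - b : 𝓞 K) : K) = a - b := rfl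
theorem val_neg (a : 𝓞 K) : ((-a : 𝓞 K) : K) = -a := rfl
theorem val_one : ((1 : 𝓞 K) : K) = 1 := rfl
theorem val_pow (a : 𝓞 K) (n : ℕ) : ((a ^ n : 𝓞 K) : K) = (a : K) ^ n :=
  map_pow (algebraMap (𝓞 K) K) a n
theorem val_intCast (n : ℤ) : ((n : 𝓞 K) : K) = n := map_intCast (algebraMap (𝓞 K) K) n
theorem val_natCast (n : ℕ) : ((n : 𝓞 K) : K) = n := map_natCast (algebraMap (𝓞 K) K) n
theorem val_toInteger {n : ℕ} [NeZero n] {ζ : K} (hζ : IsPrimitiveRoot ζ n) :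
    (hζ.toInteger : K) = ζ := rfl

end Coercions

section LocalRing

variable {p : ℕ} [hp : Fact p.Prime] {K : Type*} [Field K] {ζ : K} (hζ : IsPrimitiveRoot ζ p)

theorem mem_primePi_pow {n : ℕ} {x : 𝓞 K} :
    x ∈ primePi p hζ ^ n ↔ (1 - hζ.toInteger) ^ n ∣ x := by
  rw [primePi, Ideal.span_singleton_pow, Ideal.mem_span_singleton]

theorem mem_primePi {x : 𝓞 K} : x ∈ primePi p hζ ↔ 1 - hζ.toInteger ∣ x :=
  Ideal.mem_span_singleton

theorem coe_ne_zero_of_notMem {s : 𝓞 K} (hs : s ∉ primePi p hζ) : (s : K) ≠ 0 := fun h ↦ hs (by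
  rw [RingOfIntegers.coe_eq_zero_iff.1 h]
  exact zero_mem _)

variable [NumberField K] [IsCyclotomicExtension {p} ℚ K]

theorem prime_one_sub_zeta : Prime (1 - hζ.toInteger) := by
  rw [← neg_sub]
  exact hζ.zeta_sub_one_prime'.neg

theorem primePi_isPrime : (primePi p hζ).IsPrime :=
  (Ideal.span_singleton_prime (prime_one_sub_zeta hζ).ne_zero).2 (prime_one_sub_zeta hζ)

theorem intCast_mem_primePi {n : ℤ} : (n : 𝓞 K) ∈ primePi p hζ ↔ (p : ℤ) ∣ n := by
  rw [mem_primePi, ← neg_sub, neg_dvd]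
  exact IsCyclotomicExtension.Rat.zeta_sub_one_dvd_intCast_iff' p hζ

theorem exists_int_sub_mem_primePi (x : 𝓞 K) : ∃ n : ℤ, x - n ∈ primePi p hζ := by
  have hx : x ∈ Algebra.adjoin ℤ {hζ.toInteger} := by
    rw [← hζ.integralPowerBasis_gen, hζ.integralPowerBasis.adjoin_gen_eq_top]
    exact Algebra.mem_top
  induction hx using Algebra.adjoin_induction with
  | mem x hx =>
    refine ⟨1, ?_⟩
    rw [Set.mem_singleton_iff.1 hx, mem_primePi, Int.cast_one, ← neg_sub, neg_dvd]
  | algebraMap r => exact ⟨r, by simp⟩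
  | add x y _ _ hx hy =>
    obtain ⟨m, hm⟩ := hx
    obtain ⟨n, hn⟩ := hy
    refine ⟨m + n, ?_⟩
    rw [Int.cast_add, add_sub_add_comm]
    exact add_mem hm hn
  | mul x y _ _ hx hy =>
    obtain ⟨m, hm⟩ := hx
    obtain ⟨n, hn⟩ := hy
    refine ⟨m * n, ?_⟩
    have h : x * y - (m * n : ℤ) = (x - m) * y + (y - n) * m := by
      push_cast
      ring
    rw [h]
    exact add_mem (Ideal.mul_mem_right _ _ hm) (Ideal.mul_mem_right _ _ hn)

theorem galRing_mem_primePi (σ : Gal(K/ℚ)) {x : 𝓞 K} (hx : x ∈ primePi p hζ) :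
    galRing σ x ∈ primePi p hζ := by
  rw [mem_primePi] at hx ⊢
  refine dvd_trans ?_ (map_dvd (galRing σ) hx)
  have h1 : galRing σ hζ.toInteger =
      hζ.toInteger ^ ((IsCyclotomicExtension.Rat.galEquivZMod p K σ : (ZMod p)ˣ) : ZMod p).val := by
    apply RingOfIntegers.ext
    rw [coe_galRing, IsCyclotomicExtension.Rat.galEquivZMod_apply_of_pow_eq p K σ]
    · rfl
    · exact hζ.pow_eq_one
  rw [map_sub, map_one, h1]
  exact one_sub_dvd_one_sub_pow _ _

theorem galRing_mem_primePi_iff (σ : Gal(K/ℚ)) {x : 𝓞 K} :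
    galRing σ x ∈ primePi p hζ ↔ x ∈ primePi p hζ := by
  refine ⟨fun h ↦ ?_, galRing_mem_primePi hζ σ⟩
  have := galRing_mem_primePi hζ σ⁻¹ h
  rwa [galRing_inv_apply_self] at this

theorem galRing_sub_mem_primePi (σ : Gal(K/ℚ)) (x : 𝓞 K) : galRing σ x - x ∈ primePi p hζ := by
  obtain ⟨n, hn⟩ := exists_int_sub_mem_primePi hζ x
  have h1 := galRing_mem_primePi hζ σ hn
  rw [map_sub, map_intCast] at h1
  have h2 := sub_mem h1 hn
  rwa [sub_sub_sub_cancel_right] at h2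

/-- The localization of `𝓞 K` at `π`, as a subring of `K`. -/
def localRing : Subring K where
  carrier := {x | PiPowDvd p hζ 0 x}
  mul_mem' := by
    rintro x y ⟨a, s, -, hs, h⟩ ⟨b, t, -, ht, h'⟩
    refine ⟨a * b, s * t, by simp, fun hst ↦ ((primePi_isPrime hζ).mem_or_mem hst).elim hs ht, ?_⟩
    rw [val_mul, val_mul, ← h, ← h']
    ring
  one_mem' := ⟨1, 1, by simp, fun h ↦ (primePi_isPrime hζ).ne_top ((Ideal.eq_top_iff_one _).2 h),
    by simp⟩
  add_mem' := by
    rintro x y ⟨a, s, -, hs, h⟩ ⟨b, t, -, ht, h'⟩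
    refine ⟨a * t + b * s, s * t, by simp,
      fun hst ↦ ((primePi_isPrime hζ).mem_or_mem hst).elim hs ht, ?_⟩
    rw [val_mul, val_add, val_mul, val_mul, ← h, ← h']
    ring
  zero_mem' := ⟨0, 1, by simp, fun h ↦ (primePi_isPrime hζ).ne_top ((Ideal.eq_top_iff_one _).2 h),
    by simp⟩
  neg_mem' := by
    rintro x ⟨a, s, -, hs, h⟩
    exact ⟨-a, s, by simp, hs, by rw [val_neg, ← h]; ring⟩

theorem mem_localRing {x : K} : x ∈ localRing hζ ↔
    ∃ a s : 𝓞 K, s ∉ primePi p hζ ∧ (s : K) * x = a :=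
  ⟨fun ⟨a, s, _, hs, h⟩ ↦ ⟨a, s, hs, h⟩, fun ⟨a, s, hs, h⟩ ↦ ⟨a, s, by simp, hs, h⟩⟩

theorem coe_mem_localRing (x : 𝓞 K) : (x : K) ∈ localRing hζ :=
  (mem_localRing hζ).2 ⟨x, 1,
    fun h ↦ (primePi_isPrime hζ).ne_top ((Ideal.eq_top_iff_one _).2 h), by simp⟩

/-- The uniformizer `1 - ζ` of the local ring. -/
def unif : localRing hζ := ⟨1 - ζ, coe_mem_localRing hζ (1 - hζ.toInteger)⟩

theorem coe_unif : (unif hζ : K) = ((1 - hζ.toInteger : 𝓞 K) : K) := rfl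

theorem unif_ne_zero : unif hζ ≠ 0 := fun h ↦ (prime_one_sub_zeta hζ).ne_zero (by
  have := congrArg Subtype.val h
  rw [coe_unif] at this
  exact RingOfIntegers.coe_eq_zero_iff.1 this)

theorem piPowDvd_iff_exists {n : ℕ} {x : K} :
    PiPowDvd p hζ n x ↔ ∃ y : localRing hζ, x = (unif hζ : K) ^ n * y := by
  constructor
  · rintro ⟨a, s, ha, hs, h⟩
    obtain ⟨b, rfl⟩ := (mem_primePi_pow hζ).1 ha
    have hs0 := coe_ne_zero_of_notMem hζ hs
    refine ⟨⟨b / s, (mem_localRing hζ).2 ⟨b, s, hs, by field_simp⟩⟩, ?_⟩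
    rw [coe_unif, ← mul_div_assoc, eq_div_iff hs0, mul_comm, h, val_mul, val_pow]
  · rintro ⟨⟨y, hy⟩, rfl⟩
    obtain ⟨b, s, hs, h⟩ := (mem_localRing hζ).1 hy
    refine ⟨(1 - hζ.toInteger) ^ n * b, s, (mem_primePi_pow hζ).2 (dvd_mul_right _ _), hs, ?_⟩
    rw [coe_unif, val_mul, val_pow, ← h]
    ring

theorem piPowDvd_coe_iff {n : ℕ} {x : localRing hζ} :
    PiPowDvd p hζ n (x : K) ↔ unif hζ ^ n ∣ x := by
  rw [piPowDvd_iff_exists]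
  exact exists_congr fun y ↦ by rw [Subtype.ext_iff]; simp

theorem unif_dvd_coe_iff {x : 𝓞 K} :
    unif hζ ∣ ⟨x, coe_mem_localRing hζ x⟩ ↔ x ∈ primePi p hζ := by
  rw [← pow_one (unif hζ), ← piPowDvd_coe_iff]
  constructor
  · rintro ⟨a, s, ha, hs, h⟩
    have h1 : s * x = a := RingOfIntegers.ext (by simpa using h)
    rw [pow_one, ← h1] at ha
    exact ((primePi_isPrime hζ).mem_or_mem ha).resolve_left hs
  · intro hx
    exact ⟨x, 1, by simpa using hx,
      fun h ↦ (primePi_isPrime hζ).ne_top ((Ideal.eq_top_iff_one _).2 h), by simp⟩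

theorem unif_dvd_intCast_iff (n : ℤ) : unif hζ ∣ (n : localRing hζ) ↔ (p : ℤ) ∣ n := by
  rw [← intCast_mem_primePi hζ, ← unif_dvd_coe_iff]
  congr! 1

theorem exists_int_unif_dvd_sub (x : localRing hζ) : ∃ n : ℤ, unif hζ ∣ x - n := by
  obtain ⟨x, hx⟩ := x
  obtain ⟨a, s, hs, h⟩ := (mem_localRing hζ).1 hx
  obtain ⟨i, hi⟩ := exists_int_sub_mem_primePi hζ a
  obtain ⟨j, hj⟩ := exists_int_sub_mem_primePi hζ s
  have hpj : ¬ (p : ℤ) ∣ j := fun hd ↦ hs (by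
    have := add_mem hj ((intCast_mem_primePi hζ).2 hd)
    rwa [sub_add_cancel] at this)
  obtain ⟨k, hk⟩ : ∃ k : ℤ, (p : ℤ) ∣ i - j * k := by
    have h0 : (j : ZMod p) ≠ 0 := fun h ↦ hpj ((ZMod.intCast_zmod_eq_zero_iff_dvd _ _).1 h)
    refine ⟨((j : ZMod p)⁻¹ * i : ZMod p).val, (ZMod.intCast_zmod_eq_zero_iff_dvd _ _).1 ?_⟩
    simp [mul_inv_cancel_left₀ h0]
  refine ⟨k, ?_⟩
  have hmem : a - s * k ∈ primePi p hζ := by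
    have h1 := (intCast_mem_primePi hζ).2 hk
    push_cast at h1
    have h2 : a - s * k = (a - i) - (s - j) * k + (i - j * k) := by ring
    rw [h2]
    exact add_mem (sub_mem hi (Ideal.mul_mem_right _ _ hj)) h1
  rw [← pow_one (unif hζ), ← piPowDvd_coe_iff]
  refine ⟨a - s * k, s, by simpa using hmem, hs, ?_⟩
  rw [val_sub, val_mul, val_intCast, ← h]
  push_cast
  ring

theorem unif_pow_dvd_natCast : unif hζ ^ (p - 1) ∣ (p : localRing hζ) := by
  have h1 : (1 - hζ.toInteger) ^ (p - 1) ∣ (p : 𝓞 K) := by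
    rw [← (IsCyclotomicExtension.Rat.associated_zeta_sub_one_pow_prime p hζ).dvd_iff_dvd_right]
    exact pow_dvd_pow_of_dvd (by rw [← neg_sub, neg_dvd]) _
  obtain ⟨y, hy⟩ := h1
  refine ⟨⟨y, coe_mem_localRing hζ y⟩, Subtype.ext ?_⟩
  have := congrArg (fun x : 𝓞 K ↦ (x : K)) hy
  simp only [val_natCast, val_mul, val_pow] at this
  push_cast
  rw [coe_unif]
  exact this

theorem galois_mem_localRing (σ : Gal(K/ℚ)) {x : K} (hx : x ∈ localRing hζ) :
    σ x ∈ localRing hζ := by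
  obtain ⟨a, s, hs, h⟩ := (mem_localRing hζ).1 hx
  refine (mem_localRing hζ).2 ⟨galRing σ a, galRing σ s,
    fun h ↦ hs ((galRing_mem_primePi_iff hζ σ).1 h), ?_⟩
  rw [coe_galRing, coe_galRing, ← h, map_mul]

/-- The automorphism of the local ring induced by `σ`. -/
def galLocal (σ : Gal(K/ℚ)) : localRing hζ →+* localRing hζ :=
  (σ : K →+* K).restrict (localRing hζ) (localRing hζ) fun _ ↦ galois_mem_localRing hζ σ

theorem coe_galLocal (σ : Gal(K/ℚ)) (x : localRing hζ) : (galLocal hζ σ x : K) = σ x := rfl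

theorem galLocal_unif {σ : Gal(K/ℚ)} {u : ℕ} (hσ : σ ζ = ζ ^ u) :
    ∃ v, galLocal hζ σ (unif hζ) = unif hζ * v ∧ unif hζ ∣ v - u := by
  have hz : ((1 - unif hζ : localRing hζ) : K) = ζ := by simp [unif]
  refine ⟨∑ i ∈ Finset.range u, (1 - unif hζ) ^ i, ?_, ?_⟩
  · apply Subtype.ext
    rw [coe_galLocal]
    have h1 := mul_neg_geom_sum (1 - unif hζ) u
    rw [sub_sub_cancel] at h1
    rw [h1]
    simp only [unif, map_sub, map_one, hσ]
    simp
  · have h1 : ∀ i, unif hζ ∣ (1 - unif hζ) ^ i - 1 := fun i ↦ dvd_pow_sub_one (by simp) i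
    have h2 : ∑ i ∈ Finset.range u, (1 - unif hζ) ^ i - (u : localRing hζ) =
        ∑ i ∈ Finset.range u, ((1 - unif hζ) ^ i - 1) := by
      rw [Finset.sum_sub_distrib]
      simp
    rw [h2]
    exact Finset.dvd_sum fun i _ ↦ h1 i

theorem pow_mul_div_pow_mul_mem_localRing {a s : 𝓞 K} (hs : s ∉ primePi p hζ) {i j : ℕ}
    (hij : j ≤ i) : (((1 - hζ.toInteger) ^ i * a : 𝓞 K) : K) /
      (((1 - hζ.toInteger) ^ j * s : 𝓞 K) : K) ∈ localRing hζ := by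
  refine (mem_localRing hζ).2 ⟨(1 - hζ.toInteger) ^ (i - j) * a, s, hs, ?_⟩
  have hs0 := coe_ne_zero_of_notMem hζ hs
  have hl0 : ((1 - hζ.toInteger : 𝓞 K) : K) ≠ 0 := fun h ↦
    (prime_one_sub_zeta hζ).ne_zero (RingOfIntegers.coe_eq_zero_iff.1 h)
  rw [val_mul, val_mul, val_mul, val_pow, val_pow, val_pow, mul_div_assoc', div_eq_iff
    (mul_ne_zero (pow_ne_zero _ hl0) hs0), ← Nat.sub_add_cancel hij, pow_add, Nat.add_sub_cancel]
  ring

theorem mem_localRing_or_inv_mem (x : K) : x ∈ localRing hζ ∨ x⁻¹ ∈ localRing hζ := by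
  by_cases hx : x = 0
  · exact Or.inl (hx ▸ zero_mem _)
  obtain ⟨a, s, hs0, hxas⟩ := IsFractionRing.div_surjective (A := 𝓞 K) x
  have hs : s ≠ 0 := nonZeroDivisors.ne_zero hs0
  have ha : a ≠ 0 := by
    rintro rfl
    exact hx (by rw [← hxas, map_zero, zero_div])
  have hl := (prime_one_sub_zeta hζ).irreducible
  obtain ⟨i, a', ha', rfl⟩ := WfDvdMonoid.max_power_factor ha hl
  obtain ⟨j, s', hs', rfl⟩ := WfDvdMonoid.max_power_factor hs hl
  rw [← mem_primePi] at ha' hs'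
  rw [← hxas, inv_div]
  exact (le_total j i).imp (pow_mul_div_pow_mul_mem_localRing hζ hs')
    (pow_mul_div_pow_mul_mem_localRing hζ ha')

theorem conj_conj_apply (x : K) : conj K p (conj K p x) = x := by
  rw [← AlgEquiv.mul_apply, conj, ← map_mul, neg_mul_neg, one_mul, map_one, AlgEquiv.one_apply]

/-- The local ring is a valuation ring stable under conjugation, so it contains every `x` with
`x x̄ = 1`. -/
theorem mem_localRing_of_mul_conj {x : K} (h : x * conj K p x = 1) : x ∈ localRing hζ := by
  refine (mem_localRing_or_inv_mem hζ x).elim id fun hx ↦ ?_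
  rw [inv_eq_of_mul_eq_one_right h] at hx
  have h1 := galois_mem_localRing hζ (conj K p) hx
  rwa [conj_conj_apply] at h1

end LocalRing

/-! ### Units, generators of `b ^ p` and singular elements -/

section UnitsAndSingular

theorem isSingular_of_span_eq_pow {p : ℕ} {K : Type*} [Field K] [NumberField K]
    {b : (Ideal (𝓞 K))⁰} (hb : ClassGroup.mk0 b ≠ 1) {B : 𝓞 K}
    (hB : Ideal.span {B} = (b : Ideal (𝓞 K)) ^ p) : IsSingular p (B : K) := by
  refine ⟨FractionalIdeal.mk0 K b, by rwa [ClassGroup.mk_mk0], ?_⟩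
  rw [FractionalIdeal.coe_mk0, ← FractionalIdeal.coeIdeal_pow, ← hB,
    FractionalIdeal.coeIdeal_span_singleton]

variable {p : ℕ} [hp : Fact p.Prime] {K : Type*} [Field K] [NumberField K]
  [IsCyclotomicExtension {p} ℚ K] {ζ : K}

theorem conj_zeta_mul (hζ : IsPrimitiveRoot ζ p) : conj K p ζ * ζ = 1 := by
  rw [IsCyclotomicExtension.Rat.galEquivZMod_apply_of_pow_eq p K _ hζ.pow_eq_one, conj,
    MulEquiv.apply_symm_apply, ← pow_succ, hζ.pow_eq_one_iff_dvd, ← ZMod.natCast_eq_zero_iff]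
  simp

theorem galois_conj_apply (σ : Gal(K/ℚ)) (x : K) : σ (conj K p x) = conj K p (σ x) := by
  have h : σ * conj K p = conj K p * σ :=
    (IsCyclotomicExtension.Rat.galEquivZMod p K).injective (by rw [map_mul, map_mul, mul_comm])
  exact DFunLike.congr_fun h x

theorem div_conj_mul_conj {x : K} (hx : x ≠ 0) :
    x / conj K p x * conj K p (x / conj K p x) = 1 := by
  have : conj K p x ≠ 0 := (map_ne_zero _).2 hx
  rw [map_div₀, conj_conj_apply]
  field_simp

/-- Kummer: the quotient of a unit by its complex conjugate has absolute value `1` at all infinite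
places, so it is a root of unity. -/
theorem unit_div_conj (hp2 : p ≠ 2) (hζ : IsPrimitiveRoot ζ p) (ε : (𝓞 K)ˣ) :
    ∃ r : ℕ, ((ε : 𝓞 K) : K) / conj K p ((ε : 𝓞 K) : K) = (-ζ) ^ r := by
  have h0 : ((ε : 𝓞 K) : K) ≠ 0 := RingOfIntegers.coe_ne_zero_iff.2 ε.ne_zero
  have h1 : ((ε : 𝓞 K) : K) / conj K p ((ε : 𝓞 K) : K) =
      ((ε * galRing (conj K p) (ε⁻¹ : (𝓞 K)ˣ) : 𝓞 K) : K) := by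
    rw [div_eq_iff ((map_ne_zero _).2 h0), val_mul, coe_galRing, mul_assoc, ← map_mul, ← val_mul,
      Units.inv_mul, val_one, map_one, mul_one]
  refine IsPrimitiveRoot.exists_neg_pow_of_isOfFinOrder (n := p) (hp.out.odd_of_ne_two hp2) hζ ?_
  obtain ⟨n, hn, h⟩ := NumberField.Embeddings.pow_eq_one_of_norm_eq_one K ℂ
    (x := ((ε : 𝓞 K) : K) / conj K p ((ε : 𝓞 K) : K)) (by
      rw [h1]
      exact RingOfIntegers.isIntegral_coe _) (fun φ ↦ by
      have h2 : ‖φ ((ε : 𝓞 K) : K)‖ ≠ 0 := norm_ne_zero_iff.2 ((map_ne_zero φ).2 h0)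
      rw [map_div₀, embedding_conj, norm_div, RCLike.norm_conj, div_self h2])
  exact isOfFinOrder_iff_pow_eq_one.2 ⟨n, hn, h⟩

/-- If `σ(b)` is in the class of `b ^ k`, the number `C = B / B̄` attached to a generator `B` of
`b ^ p` satisfies `σ(C) = C ^ k β ^ p ζ ^ i`, where `β β̄ = 1`. -/
theorem galois_div_conj (hp2 : p ≠ 2) (hζ : IsPrimitiveRoot ζ p) (σ : Gal(K/ℚ))
    (b : (Ideal (𝓞 K))⁰) (k : ℕ) (h : galClass σ (ClassGroup.mk0 b) = ClassGroup.mk0 b ^ k)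
    {B : 𝓞 K} (hB : Ideal.span {B} = (b : Ideal (𝓞 K)) ^ p) :
    ∃ (β : K) (i : ℕ), β * conj K p β = 1 ∧
      σ ((B : K) / conj K p B) = ((B : K) / conj K p B) ^ k * β ^ p * ζ ^ i := by
  rw [galClass_mk0, ← map_pow, ClassGroup.mk0_eq_mk0_iff] at h
  obtain ⟨x, y, hx, hy, hxy⟩ := h
  have hxy' : Ideal.span {x} * (b : Ideal (𝓞 K)).map (galRing σ) =
      Ideal.span {y} * (b : Ideal (𝓞 K)) ^ k := hxy
  have hBσ : (b : Ideal (𝓞 K)).map (galRing σ) ^ p = Ideal.span {galRing σ B} := by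
    rw [← Ideal.map_pow, ← hB, Ideal.map_span, Set.image_singleton]
  have h1 : Ideal.span {x ^ p * galRing σ B} = Ideal.span {y ^ p * B ^ k} := by
    rw [← Ideal.span_singleton_mul_span_singleton, ← Ideal.span_singleton_mul_span_singleton,
      ← Ideal.span_singleton_pow, ← Ideal.span_singleton_pow, ← Ideal.span_singleton_pow, ← hBσ, hB,
      ← mul_pow, hxy', mul_pow, pow_right_comm]
  obtain ⟨ε, hε⟩ := (Ideal.span_singleton_eq_span_singleton.1 h1).symm
  have hB0 : B ≠ 0 := by
    rintro rfl
    rw [Ideal.span_singleton_zero] at hB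
    exact nonZeroDivisors.coe_ne_zero b (pow_eq_zero_iff hp.out.ne_zero |>.1 hB.symm)
  have hBK : (B : K) ≠ 0 := RingOfIntegers.coe_ne_zero_iff.2 hB0
  have hxK : (x : K) ≠ 0 := RingOfIntegers.coe_ne_zero_iff.2 hx
  have hyK : (y : K) ≠ 0 := RingOfIntegers.coe_ne_zero_iff.2 hy
  have hεK : ((ε : 𝓞 K) : K) ≠ 0 := RingOfIntegers.coe_ne_zero_iff.2 ε.ne_zero
  have h2 : (x : K) ^ p * σ B = (y : K) ^ p * (B : K) ^ k * ((ε : 𝓞 K) : K) := by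
    have := congrArg (fun z : 𝓞 K ↦ (z : K)) hε
    simp only [val_mul, val_pow, coe_galRing] at this
    exact this.symm
  have h3 : σ (B : K) = ((y : K) / x) ^ p * (B : K) ^ k * ((ε : 𝓞 K) : K) := by
    rw [div_pow]
    field_simp
    linear_combination h2
  obtain ⟨r, hr⟩ := unit_div_conj hp2 hζ ε
  set z : K := (y : K) / x with hz
  have hz0 : z ≠ 0 := div_ne_zero hyK hxK
  have hodd : ((-1 : K) ^ r) ^ p = (-1) ^ r := by
    rw [pow_right_comm, (hp.out.odd_of_ne_two hp2).neg_one_pow]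
  refine ⟨z / conj K p z * (-1) ^ r, r, ?_, ?_⟩
  · have h4 := div_conj_mul_conj (p := p) hz0
    rw [map_mul, map_pow, map_neg, map_one, mul_mul_mul_comm, h4, one_mul, ← mul_pow]
    simp
  · have h5 : conj K p z ≠ 0 := (map_ne_zero _).2 hz0
    have h6 : conj K p (B : K) ≠ 0 := (map_ne_zero _).2 hBK
    have h7 : conj K p ((ε : 𝓞 K) : K) ≠ 0 := (map_ne_zero _).2 hεK
    have h8 : (-1 : K) ^ r * ζ ^ r = ((ε : 𝓞 K) : K) / conj K p ((ε : 𝓞 K) : K) := by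
      rw [← mul_pow, neg_one_mul, hr]
    have h9 : ((B : K) / conj K p B) ^ k * (z / conj K p z * (-1) ^ r) ^ p * ζ ^ r =
        ((B : K) / conj K p B) ^ k * (z / conj K p z) ^ p * ((-1 : K) ^ r * ζ ^ r) := by
      rw [mul_pow, hodd]
      ring
    clear_value z
    rw [h9, h8, map_div₀, galois_conj_apply σ, h3, map_mul, map_mul, map_pow, map_pow, div_pow,
      div_pow]
    field_simp

theorem isSingular_div_conj (hp2 : p ≠ 2) {b : (Ideal (𝓞 K))⁰} (hb : ClassGroup.mk0 b ≠ 1)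
    (hbminus : ClassGroup.mk0 b ∈ classMinus K p) {B : 𝓞 K}
    (hB : Ideal.span {B} = (b : Ideal (𝓞 K)) ^ p) : IsSingular p ((B : K) / conj K p B) := by
  have hcp : ClassGroup.mk0 b ^ p = 1 := hbminus.1
  have hconj : ClassGroup.mk0 b * galClass (conj K p) (ClassGroup.mk0 b) = 1 := hbminus.2
  have hB' : Ideal.span {galRing (conj K p) B} = (galIdeal (conj K p) b : Ideal (𝓞 K)) ^ p := by
    have := congrArg (Ideal.map (galRing (conj K p))) hB
    rwa [Ideal.map_span, Set.image_singleton, Ideal.map_pow] at this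
  refine ⟨FractionalIdeal.mk0 K b / FractionalIdeal.mk0 K (galIdeal (conj K p) b), ?_, ?_⟩
  · rw [map_div, ClassGroup.mk_mk0, ClassGroup.mk_mk0, ← galClass_mk0, div_eq_mul_inv,
      ← eq_inv_of_mul_eq_one_left hconj]
    intro h
    rw [← sq] at h
    refine hb (eq_one_of_pow_prime_pow_eq_one (p := p) (N := 1) (by simpa using hcp) (k := 2) ?_ h)
    exact_mod_cast fun h ↦ hp2 ((Nat.prime_dvd_prime_iff_eq hp.out Nat.prime_two).1
      ((ZMod.natCast_eq_zero_iff 2 p).1 h))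
  · rw [Units.val_div_eq_div_val, div_pow,
      FractionalIdeal.coe_mk0, FractionalIdeal.coe_mk0, ← FractionalIdeal.coeIdeal_pow,
      ← FractionalIdeal.coeIdeal_pow, ← hB, ← hB', FractionalIdeal.coeIdeal_span_singleton,
      FractionalIdeal.coeIdeal_span_singleton, FractionalIdeal.spanSingleton_div_spanSingleton]
    rfl

end UnitsAndSingular

/-! ### The eigenvalue of `σ` -/

section Eigenvalue

variable {p : ℕ} [hp : Fact p.Prime] {K : Type*} [Field K] [NumberField K]
  [IsCyclotomicExtension {p} ℚ K] {ζ : K}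

theorem galClass_pow_apply (σ : Gal(K/ℚ)) {c : ClassGroup (𝓞 K)} {k : ℕ}
    (h : galClass σ c = c ^ k) (n : ℕ) : galClass (σ ^ n) c = c ^ k ^ n := by
  induction n with
  | zero => rw [pow_zero, pow_zero, pow_one, galClass_one_apply]
  | succ n ih =>
    rw [pow_succ, galClass_mul_apply, h, map_pow, ih, ← pow_mul, ← pow_succ]

/-- On a nontrivial class of `C_p⁻` which is an eigenvector of `σ`, the eigenvalue is an odd power
`u ^ (2 m + 1)` with `m ≠ 0`. The power is odd because complex conjugation acts by `-1`, and `u`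
itself is not an eigenvalue by Stickelberger's relation. -/
theorem exists_eigenvalue_eq_pow (hp2 : p ≠ 2) (hζ : IsPrimitiveRoot ζ p) {u : ℕ}
    (hu : IsPrimitiveRoot (u : ZMod p) (p - 1)) {σ : Gal(K/ℚ)} (hσ : σ ζ = ζ ^ u)
    {c : ClassGroup (𝓞 K)} (hc : c ≠ 1) (hcm : c ∈ classMinus K p) {μ : ZMod p}
    (hμ : galClass σ c = c ^ μ.val) :
    ∃ m : ℕ, 1 ≤ m ∧ m ≤ (p - 3) / 2 ∧ μ = (u : ZMod p) ^ (2 * m + 1) := by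
  have hcp : c ^ p = 1 := hcm.1
  have hconj : c * galClass (conj K p) c = 1 := hcm.2
  have hord : orderOf c = p := orderOf_eq_prime hcp hc
  have hp3 : 3 ≤ p := by
    have := hp.out.two_le
    lia
  have hpow : ∀ m n : ℕ, c ^ m = c ^ n ↔ (m : ZMod p) = n := fun m n ↦ by
    rw [pow_eq_pow_iff_modEq, hord, ZMod.natCast_eq_natCast_iff]
  have hu0 : (u : ZMod p) ≠ 0 := hu.ne_zero (by lia)
  have hμ0 : μ ≠ 0 := by
    rintro rfl
    rw [ZMod.val_zero, pow_zero] at hμ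
    exact hc ((MulEquiv.map_eq_one_iff _).1 hμ)
  have : NeZero (p - 1) := ⟨by lia⟩
  obtain ⟨k, hk, hkμ⟩ := hu.eq_pow_of_pow_eq_one (ZMod.pow_card_sub_one_eq_one hμ0)
  have hσu : galOf K (Units.mk0 _ hu0) = σ := by
    rw [MulEquiv.symm_apply_eq]
    apply Units.ext
    have h1 := IsCyclotomicExtension.Rat.galEquivZMod_apply_of_pow_eq p K σ hζ.pow_eq_one
    rw [hσ, (hζ.isOfFinOrder hp.out.ne_zero).pow_eq_pow_iff_modEq, ← hζ.eq_orderOf,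
      ← ZMod.natCast_eq_natCast_iff] at h1
    simpa using h1
  have hpow_gal : ∀ n : ℕ, galClass (galOf K (Units.mk0 _ hu0 ^ n)) c = c ^ μ.val ^ n := fun n ↦ by
    rw [map_pow, hσu]
    exact galClass_pow_apply σ hμ n
  -- `k ≠ 1`: otherwise `c` would be in the eigenspace of the tautological character.
  have hk1 : k ≠ 1 := by
    rintro rfl
    refine hc (eigenclass_classGroup_eq_one hp2 hζ c hcp fun a ↦ ?_)
    obtain ⟨n, -, hn⟩ := hu.eq_pow_of_pow_eq_one (ZMod.pow_card_sub_one_eq_one a.ne_zero)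
    have ha : a = Units.mk0 _ hu0 ^ n := Units.ext (by rw [← hn]; simp)
    rw [ha, hpow_gal, hpow]
    simp [← hkμ]
  -- `k` is odd: `σ ^ ((p - 1) / 2)` is complex conjugation.
  have heven : (p - 1) / 2 * 2 = p - 1 :=
    Nat.div_mul_cancel (hp.out.even_sub_one hp2).two_dvd
  have hhalf : (u : ZMod p) ^ ((p - 1) / 2) = -1 := by
    have h1 : ((u : ZMod p) ^ ((p - 1) / 2)) ^ 2 = 1 := by rw [← pow_mul, heven, hu.pow_eq_one]
    refine (sq_eq_one_iff.1 h1).resolve_left fun h ↦ ?_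
    exact hu.pow_ne_one_of_pos_of_lt (by lia) (by lia) h
  have hunit : Units.mk0 _ hu0 ^ ((p - 1) / 2) = (-1 : (ZMod p)ˣ) :=
    Units.ext (by simpa using hhalf)
  have h1 := hpow_gal ((p - 1) / 2)
  rw [hunit] at h1
  have h2 : c ^ (1 + μ.val ^ ((p - 1) / 2)) = c ^ 0 := by
    rw [pow_add, pow_one, pow_zero, ← h1]
    exact hconj
  rw [hpow] at h2
  have hkodd : Odd k := by
    rw [← Nat.not_even_iff_odd]
    rintro ⟨t, rfl⟩
    have h3 : μ ^ ((p - 1) / 2) = 1 := by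
      have h4 : (t + t) * ((p - 1) / 2) = (p - 1) * t := by
        calc (t + t) * ((p - 1) / 2) = (p - 1) / 2 * 2 * t := by ring
          _ = (p - 1) * t := by rw [heven]
      rw [← hkμ, ← pow_mul, h4, pow_mul, hu.pow_eq_one, one_pow]
    push_cast [ZMod.natCast_val, ZMod.cast_id'] at h2
    rw [id, h3, one_add_one_eq_two] at h2
    exact hp2 ((Nat.prime_dvd_prime_iff_eq hp.out Nat.prime_two).1
      ((ZMod.natCast_eq_zero_iff 2 p).1 (by exact_mod_cast h2)))
  obtain ⟨m, rfl⟩ := hkodd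
  exact ⟨m, by lia, by lia, hkμ.symm⟩

end Eigenvalue

/-! ### The Galois relation in the local ring -/

section LocalRelation

variable {p : ℕ} [hp : Fact p.Prime] {K : Type*} [Field K] [NumberField K]
  [IsCyclotomicExtension {p} ℚ K] {ζ : K} (hζ : IsPrimitiveRoot ζ p)

theorem coe_one_sub_unif : ((1 - unif hζ : localRing hζ) : K) = ζ := by simp [unif]

theorem one_sub_unif_pow_prime : (1 - unif hζ) ^ p = 1 :=
  Subtype.ext (by rw [Subring.coe_pow, coe_one_sub_unif, hζ.pow_eq_one]; rfl)

/-- The relation of `galois_div_conj` takes place in the local ring at `π`. -/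
theorem exists_local_relation (hp2 : p ≠ 2) {σ : Gal(K/ℚ)} {b : (Ideal (𝓞 K))⁰} {k : ℕ}
    (h : galClass σ (ClassGroup.mk0 b) = ClassGroup.mk0 b ^ k)
    {B : 𝓞 K} (hB : Ideal.span {B} = (b : Ideal (𝓞 K)) ^ p) :
    ∃ (c β : localRing hζ) (i : ℕ), (c : K) = (B : K) / conj K p B ∧
      galLocal hζ σ c = c ^ k * β ^ p * (1 - unif hζ) ^ i := by
  have hB0 : B ≠ 0 := by
    rintro rfl
    rw [Ideal.span_singleton_zero] at hB
    exact nonZeroDivisors.coe_ne_zero b (pow_eq_zero_iff hp.out.ne_zero |>.1 hB.symm)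
  obtain ⟨β, i, hβ, hrel⟩ := galois_div_conj hp2 hζ σ b k h hB
  refine ⟨⟨_, mem_localRing_of_mul_conj hζ
    (div_conj_mul_conj (RingOfIntegers.coe_ne_zero_iff.2 hB0))⟩,
    ⟨β, mem_localRing_of_mul_conj hζ hβ⟩, i, rfl, Subtype.ext ?_⟩
  rw [coe_galLocal]
  simp only [Subring.coe_mul, Subring.coe_pow, coe_one_sub_unif]
  exact hrel

variable {hζ}

theorem unif_dvd_galLocal_sub_one {σ : Gal(K/ℚ)} {u : ℕ} (hσ : σ ζ = ζ ^ u) {c : localRing hζ}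
    {n : ℕ} (hc : unif hζ ^ n ∣ c - 1) : unif hζ ^ n ∣ galLocal hζ σ c - 1 := by
  obtain ⟨v, hv, -⟩ := galLocal_unif hζ hσ
  have := dvd_map_of_dvd hv hc
  rwa [map_sub, map_one] at this

theorem pow_prime_dvd_galLocal_sub_pow {σ : Gal(K/ℚ)} {u : ℕ} (hσ : σ ζ = ζ ^ u)
    {c β : localRing hζ} {k : ℕ} (hc : unif hζ ∣ c - 1)
    (hrel : galLocal hζ σ c = c ^ k * β ^ p) : unif hζ ^ p ∣ galLocal hζ σ c - c ^ k := by
  have h1 := unif_dvd_galLocal_sub_one hσ (n := 1) ((pow_one (unif hζ)).symm ▸ hc)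
  rw [pow_one] at h1
  have h2 := pow_dvd_pow_prime_sub_one_of_eq (exists_int_unif_dvd_sub hζ)
    (unif_dvd_intCast_iff hζ) (unif_pow_dvd_natCast hζ) h1 (dvd_pow_sub_one hc k) hrel
  have h3 : galLocal hζ σ c - c ^ k = c ^ k * (β ^ p - 1) := by rw [hrel]; ring
  rw [h3]
  exact h2.mul_left _

/-- The root of unity in the relation is trivial as soon as `c ≡ 1 mod π²`, because
`ζ ^ i ≡ 1 - i (1 - ζ) mod π²`. -/
theorem one_sub_unif_pow_eq_one {σ : Gal(K/ℚ)} {u : ℕ} (hσ : σ ζ = ζ ^ u)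
    {c β : localRing hζ} {k i : ℕ} (hc : unif hζ ^ 2 ∣ c - 1)
    (hrel : galLocal hζ σ c = c ^ k * β ^ p * (1 - unif hζ) ^ i) : (1 - unif hζ) ^ i = 1 := by
  set Z := (1 - unif hζ) ^ i with hZ
  have hc1 : unif hζ ∣ c - 1 := (dvd_pow_self _ two_ne_zero).trans hc
  have hZ1 : unif hζ ∣ Z - 1 := dvd_pow_sub_one (by simp) i
  have h1 := unif_dvd_galLocal_sub_one hσ hc
  have h2 : unif hζ ∣ c ^ k * Z - 1 := by
    have : c ^ k * Z - 1 = (c ^ k - 1) * Z + (Z - 1) := by ring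
    rw [this]
    exact dvd_add ((dvd_pow_sub_one hc1 k).mul_right _) hZ1
  have h3 := pow_dvd_pow_prime_sub_one_of_eq (exists_int_unif_dvd_sub hζ)
    (unif_dvd_intCast_iff hζ) (unif_pow_dvd_natCast hζ)
    ((dvd_pow_self _ two_ne_zero).trans h1) h2 (hrel.trans (mul_right_comm _ _ _))
  have h4 : unif hζ ^ 2 ∣ Z - 1 := by
    have : Z - 1 = (galLocal hζ σ c - 1) - (c ^ k - 1) * (β ^ p * Z) - (β ^ p - 1) * Z := by
      rw [hrel]; ring
    rw [this]
    exact dvd_sub (dvd_sub h1 ((dvd_pow_sub_one hc k).mul_right _))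
      (((pow_dvd_pow _ hp.out.two_le).trans h3).mul_right _)
  obtain ⟨j, rfl⟩ := dvd_of_sq_dvd_one_sub_pow_sub_one (unif_ne_zero hζ)
    (unif_dvd_intCast_iff hζ) h4
  rw [hZ, pow_mul, one_sub_unif_pow_prime, one_pow]

/-- A primary element which is `1` modulo `π` is `1` modulo `π ^ p`. -/
theorem unif_pow_prime_dvd_of_isPrimary {c : localRing hζ} (hc : unif hζ ∣ c - 1)
    (h : IsPrimary p hζ (c : K)) : unif hζ ^ p ∣ c - 1 := by
  obtain ⟨a, -, ha⟩ := h
  have h1 : unif hζ ^ p ∣ c - (a : localRing hζ) ^ p := by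
    rw [← piPowDvd_coe_iff]
    exact ha
  have h2 : unif hζ ∣ (a : localRing hζ) ^ p - 1 := by
    have : (a : localRing hζ) ^ p - 1 = (c - 1) - (c - (a : localRing hζ) ^ p) := by ring
    rw [this]
    exact dvd_sub hc ((dvd_pow_self _ hp.out.ne_zero).trans h1)
  have h3 := pow_dvd_pow_prime_sub_one (unif_pow_dvd_natCast hζ)
    (dvd_sub_one_of_dvd_pow_prime_sub_one (exists_int_unif_dvd_sub hζ)
      (unif_dvd_intCast_iff hζ) h2)
  have h4 : c - 1 = (c - (a : localRing hζ) ^ p) + ((a : localRing hζ) ^ p - 1) := by ring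
  rw [h4]
  exact dvd_add h1 h3

theorem piPowDvd_sub_one_iff {c : localRing hζ} {n : ℕ} :
    PiPowDvd p hζ n ((c : K) - 1) ↔ unif hζ ^ n ∣ c - 1 := by
  rw [← piPowDvd_coe_iff]
  rfl

theorem piPowDvd_one_div_conj_sub_one {B : 𝓞 K} (hB : B ∉ primePi p hζ) :
    PiPowDvd p hζ 1 ((B : K) / conj K p B - 1) := by
  have h1 : galRing (conj K p) B ∉ primePi p hζ := fun h ↦
    hB ((galRing_mem_primePi_iff hζ _).1 h)
  refine ⟨B - galRing (conj K p) B, galRing (conj K p) B, ?_, h1, ?_⟩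
  · rw [pow_one, ← neg_sub]
    exact neg_mem (galRing_sub_mem_primePi hζ _ B)
  · have h2 : conj K p (B : K) ≠ 0 := coe_ne_zero_of_notMem hζ h1
    rw [val_sub, coe_galRing]
    field_simp

theorem notMem_primePi_of_span_eq_pow {b : Ideal (𝓞 K)} (hbπ : b ⊔ primePi p hζ = ⊤) {B : 𝓞 K}
    (hB : Ideal.span {B} = b ^ p) : B ∉ primePi p hζ := fun h ↦ by
  have h1 : b ^ p ≤ primePi p hζ := by
    rw [← hB]
    exact (Ideal.span_singleton_le_iff_mem _).2 h
  have h2 := (primePi_isPrime hζ).le_of_pow_le h1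
  rw [sup_eq_right.2 h2] at hbπ
  exact (primePi_isPrime hζ).ne_top hbπ

/-- When the eigenvalue `k` differs from `u`, the root of unity in the relation
can be absorbed by multiplying `B` by a power of `ζ`. -/
theorem exists_generator_of_relation (hp2 : p ≠ 2) {σ : Gal(K/ℚ)} {u : ℕ} (hσ : σ ζ = ζ ^ u)
    {k : ℕ} (hku : (k : ZMod p) ≠ u) {B : 𝓞 K} {c β : localRing hζ} {i : ℕ}
    (hc : (c : K) = (B : K) / conj K p B)
    (hrel : galLocal hζ σ c = c ^ k * β ^ p * (1 - unif hζ) ^ i) :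
    ∃ (B' : 𝓞 K) (c' : localRing hζ), Ideal.span {B'} = Ideal.span {B} ∧
      (c' : K) = (B' : K) / conj K p B' ∧ galLocal hζ σ c' = c' ^ k * β ^ p := by
  have h2 : (2 : ZMod p) ≠ 0 := by
    have : ((2 : ℕ) : ZMod p) ≠ 0 := fun h ↦ hp2
      ((Nat.prime_dvd_prime_iff_eq hp.out Nat.prime_two).1 ((ZMod.natCast_eq_zero_iff 2 p).1 h))
    exact_mod_cast this
  obtain ⟨j, hj⟩ : ∃ j : ℕ, ((i + 2 * j * u : ℕ) : ZMod p) = (2 * j * k : ℕ) := by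
    have h3 : (k : ZMod p) - u ≠ 0 := sub_ne_zero.2 hku
    refine ⟨((i : ZMod p) / (2 * (k - u))).val, ?_⟩
    push_cast [ZMod.natCast_val, ZMod.cast_id']
    rw [id]
    field_simp
    ring
  set z := 1 - unif hζ with hz
  have hzζ : (z : K) = ζ := coe_one_sub_unif hζ
  have hzp : z ^ p = 1 := one_sub_unif_pow_prime hζ
  have hzσ : galLocal hζ σ z = z ^ u := Subtype.ext (by
    rw [coe_galLocal, Subring.coe_pow, hzζ, hσ])
  have hunit : IsUnit hζ.toInteger := hζ.toInteger_isPrimitiveRoot.isUnit hp.out.ne_zero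
  refine ⟨B * hζ.toInteger ^ j, c * z ^ (2 * j), ?_, ?_, ?_⟩
  · exact Ideal.span_singleton_mul_right_unit (hunit.pow j) B
  -- Multiplying `B` by `ζ ^ j` multiplies `B / B̄` by `ζ ^ (2 * j)`.
  · have h4 := conj_zeta_mul hζ
    have h5 : conj K p ζ = ζ⁻¹ := eq_inv_of_mul_eq_one_left h4
    rw [Subring.coe_mul, Subring.coe_pow, hc, hzζ, val_mul, val_pow, val_toInteger, map_mul,
      map_pow, h5, inv_pow, div_mul_eq_mul_div, mul_comm 2 j, pow_mul, sq]
    have : ζ ≠ 0 := hζ.ne_zero hp.out.ne_zero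
    field_simp
  · rw [map_mul, map_pow, hrel, hzσ, mul_pow, ← pow_mul, ← pow_mul]
    have h6 : z ^ i * z ^ (u * (2 * j)) = z ^ (2 * j * k) := by
      rw [← pow_add, mul_comm u]
      exact pow_eq_pow_of_modEq ((ZMod.natCast_eq_natCast_iff _ _ _).1 hj) hzp
    rw [← h6]
    ring

end LocalRelation

end CycloSingular

theorem lemmal108171 (p : ℕ) [Fact p.Prime] (hp : p ≠ 2)
    (K : Type*) [Field K] [NumberField K] [IsCyclotomicExtension {p} ℚ K]
    (ζ : K) (hζ : IsPrimitiveRoot ζ p)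
    (u : ℕ) (hu : IsPrimitiveRoot (u : ZMod p) (p - 1))
    (σ : Gal(K/ℚ)) (hσ : σ ζ = ζ ^ u)
    (b : (Ideal (𝓞 K))⁰)
    (hb : ClassGroup.mk0 b ≠ 1)
    (hbπ : (b : Ideal (𝓞 K)) ⊔ CycloSingular.primePi p hζ = ⊤)
    (hbminus : ClassGroup.mk0 b ∈ CycloSingular.classMinus K p)
    (μ : ZMod p)
    (hμ : CycloSingular.galClass σ (ClassGroup.mk0 b) = ClassGroup.mk0 b ^ μ.val) :
    ∃ m : ℕ, 1 ≤ m ∧ m ≤ (p - 3) / 2 ∧ μ = (u : ZMod p) ^ (2 * m + 1) ∧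
      (∃ B : 𝓞 K, CycloSingular.IsSingular p (B : K) ∧
        Ideal.span {B} = (b : Ideal (𝓞 K)) ^ p ∧
        CycloSingular.PiPowDvd p hζ (2 * m + 1)
          ((B : K) / CycloSingular.conj K p (B : K) - 1)) ∧
      ∀ B : 𝓞 K, Ideal.span {B} = (b : Ideal (𝓞 K)) ^ p →
        ∀ C : K, C = (B : K) / CycloSingular.conj K p (B : K) →
          CycloSingular.PiPowDvd p hζ (2 * m + 1) (C - 1) →
          (CycloSingular.IsSingular p C ∧ ¬ CycloSingular.IsPrimary p hζ C ∧
              CycloSingular.PiPowExact p hζ (2 * m + 1) (C - 1)) ∨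
            (CycloSingular.IsSingular p C ∧ CycloSingular.IsPrimary p hζ C ∧
              CycloSingular.PiPowDvd p hζ p (C - 1)) := by
  open CycloSingular in
  have hp' : p.Prime := Fact.out
  obtain ⟨m, hm1, hm2, hμu⟩ := exists_eigenvalue_eq_pow hp hζ hu hσ hb hbminus hμ
  have hp5 : 2 * m + 1 + 2 ≤ p := by
    have := hp'.two_le
    have := hp'.odd_of_ne_two hp
    lia
  have hμval : ((μ.val : ℕ) : ZMod p) = (u : ZMod p) ^ (2 * m + 1) := by
    rw [ZMod.natCast_val, ZMod.cast_id', id, hμu]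
  obtain ⟨v, hv, hvu⟩ := galLocal_unif hζ hσ
  have hladder := @pow_dvd_sub_one_of_le _ _ p _ _ _ (unif_ne_zero hζ) (exists_int_unif_dvd_sub hζ)
    (unif_dvd_intCast_iff hζ) _ _ _ hv hvu
  refine ⟨m, hm1, hm2, hμu, ?_, ?_⟩
  · obtain ⟨B₀, hB₀⟩ : ∃ B : 𝓞 K, (b : Ideal (𝓞 K)) ^ p = Ideal.span {B} := by
      have h1 : ClassGroup.mk0 (b ^ p) = 1 := by
        rw [map_pow]
        exact hbminus.1
      obtain ⟨B, hB⟩ := (ClassGroup.mk0_eq_one_iff (b ^ p).2).1 h1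
      exact ⟨B, hB⟩
    obtain ⟨c₀, β, i, hc₀, hrel₀⟩ := exists_local_relation hζ hp hμ hB₀.symm
    have hμ_ne : ((μ.val : ℕ) : ZMod p) ≠ u := fun h ↦ by
      rw [hμval] at h
      have := hu.pow_inj (i := 2 * m + 1) (j := 1) (by lia) (by lia) (by rw [h, pow_one])
      lia
    obtain ⟨B, c, hBB₀, hc, hrel⟩ := exists_generator_of_relation hp hσ hμ_ne hc₀ hrel₀
    have hB : Ideal.span {B} = (b : Ideal (𝓞 K)) ^ p := hBB₀.trans hB₀.symm
    refine ⟨B, isSingular_of_span_eq_pow hb hB, hB, ?_⟩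
    have h1 := piPowDvd_one_div_conj_sub_one (notMem_primePi_of_span_eq_pow hbπ hB)
    rw [← hc, piPowDvd_sub_one_iff] at h1 ⊢
    refine hladder (pow_prime_dvd_galLocal_sub_pow hσ (by rwa [pow_one] at h1) hrel) le_rfl
      (by lia) (by lia) (fun j hj1 hj2 h ↦ ?_) h1
    rw [hμval] at h
    have := hu.pow_inj (by lia) (by lia) h
    lia
  · rintro B hB C rfl hC
    have hsing := isSingular_div_conj hp hb hbminus hB
    obtain ⟨c, β, i, hc, hrel⟩ := exists_local_relation hζ hp hμ hB
    rw [← hc] at hC hsing ⊢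
    have hC' := piPowDvd_sub_one_iff.1 hC
    have hc1 : unif hζ ∣ c - 1 := (dvd_pow_self _ (by lia)).trans hC'
    rw [one_sub_unif_pow_eq_one hσ ((pow_dvd_pow _ (by lia)).trans hC') hrel, mul_one] at hrel
    by_cases h : PiPowDvd p hζ (2 * m + 1 + 1) ((c : K) - 1)
    · right
      have h1 : unif hζ ^ p ∣ c - 1 := by
        refine hladder (pow_prime_dvd_galLocal_sub_pow hσ hc1 hrel) (by lia) (by lia) le_rfl
          (fun j hj1 hj2 hj ↦ ?_) (piPowDvd_sub_one_iff.1 h)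
        rw [hμval] at hj
        rcases (by lia : j < p - 1 ∨ j = p - 1) with hjp | rfl
        · have := hu.pow_inj hjp (by lia) hj
          lia
        -- `u ^ (p - 1) = u ^ 0`, and `0 ≠ 2 * m + 1`.
        · rw [hu.pow_eq_one, ← pow_zero (u : ZMod p)] at hj
          have := hu.pow_inj (by lia) (by lia) hj
          lia
      have h2 := piPowDvd_sub_one_iff.2 h1
      refine ⟨hsing, ⟨1, ?_, by simpa using h2⟩, h2⟩
      exact_mod_cast hp'.not_dvd_one
    · left
      refine ⟨hsing, fun hprim ↦ h (piPowDvd_sub_one_iff.2 ?_), hC, h⟩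
      exact (pow_dvd_pow _ (by lia)).trans (unif_pow_prime_dvd_of_isPrimary hc1 hprim)
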